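/- **Theorem (Identifiability condition).** Let $(\mathcal X,\varphi)$ be a $*$-probability space: $\mathcal X$ is a unital complex $*$-algebra and $\varphi:\mathcal X\to\mathbb C$ is linear with $\varphi(aa^*)\ge 0$, $\varphi(ab)=\varphi(ba)$ and $\varphi(1)=1$. Let $\bm Q,\bm W\in\bm O(s)$ be real orthogonal $s\times s$ matrices, let $\bm x=(x_1,\dots,x_s)^T$ have entries in $\mathcal X$, and let $\bm y=\bm Q\bm x$. Assume that we are in one of the following two settings. 1. *Self-adjoint setting.* The $x_i$ are self-adjoint with $\varphi(x_i)=0$ and $\varphi(x_i^2)=1$; they are free (the unital subalgebras generated by $\{x_i,x_i^*\}$ are free with respect to $\varphi$); at most one $x_i$ is semicircular; and the components of $\bm W^T\bm y$ are free. Here $a\in\mathcal X$ is semicircular if $\kappa_2(a,a)>0$ and $\kappa_m(a,\dots,a)=0$ for all $m\ge 3$, where the free cumulants $\kappa_n$ are defined by $\varphi(a_1\cdots a_n)=\sum_{\pi\in NC(n)}\prod_{B\in\pi}\kappa_{|B|}(a_i:i\in B)$, the sum being over the non-crossing partitions of $\{1,\dots,n\}$. 2. *Rectangular setting.* There are self-adjoint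 projections $p_1,p_2\in\mathcal X$ with $p_1p_2=p_2p_1=0$, $p_1+p_2=1$ and $\rho_k:=\varphi(p_k)\neq 0$. Put $\varphi_k(a)=\varphi(p_kap_k)/\rho_k$, let $\mathcal D$ be the linear span of $p_1,p_2$, and let $\mathbb E_{\mathcal D}(a)=\varphi_1(a)p_1+\varphi_2(a)p_2$. The $x_i$ lie in $p_1\mathcal Xp_2$ with $\varphi_1(x_ix_i^*)=1$; they are free with amalgamation over $\mathcal D$ (the subalgebras generated by $\mathcal D,x_i,x_i^*$ are free with respect to $\mathbb E_{\mathcal D}$); at most one $x_i$ is free Poisson; and the components of $\bm W^T\bm y$ are free with amalgamation over $\mathcal D$. Here $a\in p_1\mathcal Xp_2$ is free Poisson if $\kappa_{2m}(a\otimes a^*\otimes\cdots\otimes a\otimes a^*)=0$ for all $m\ge 2$, where $\kappa_n$ is the coefficient of $p_1$ in the $\mathcal D$-valued free cumulant $c_n$, and the $c_n$ are defined by $\mathbb E_{\mathcal D}(a_1\cdots a_n)=\sum_{\pi\in NC(n)}c_\pi(a_1\otimes\cdots\otimes a_n)$ with $c_\pi$ the nested evaluation of the $c_k$ along the blocks of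 $\pi$. Then $\bm W=\bm Q\bm P\bm S$ for some permutation matrix $\bm P$ and some diagonal matrix $\bm S$ with diagonal entries $\pm1$. That is, $\bm W$ is obtained by permuting the columns of $\bm Q$ with possible sign flips, and vice versa: also $\bm Q=\bm W\bm P'\bm S'$ for some permutation matrix $\bm P'$ and some diagonal matrix $\bm S'$ with diagonal entries $\pm1$. -/

import Mathlib

namespace FreeICA

open scoped ComplexOrder

/-! ### Probability spaces -/

/-- `φ` makes the unital `*`-algebra `X` a (tracial) `*`-probability space. -/
structure IsTracialState {X : Type*} [Ring X] [StarRing X] [Algebra ℂ X]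
    (φ : X →ₗ[ℂ] ℂ) : Prop where
  nonneg : ∀ a : X, 0 ≤ φ (a * star a)
  tracial : ∀ a b : X, φ (a * b) = φ (b * a)
  map_one : φ 1 = 1

/-- `p₁, p₂` turn the `*`-probability space `(X, φ)` into a `(φ p₁, φ p₂)`-rectangular probability
space: orthogonal self-adjoint projections with sum `1`, for which the normalised functionals
`φ_k = φ / φ p_k` make sense. -/
structure IsRectangular {X : Type*} [Ring X] [StarRing X] [Algebra ℂ X]
    (φ : X →ₗ[ℂ] ℂ) (p₁ p₂ : X) : Prop where
  proj₁ : IsStarProjection p₁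
  proj₂ : IsStarProjection p₂
  mul₁₂ : p₁ * p₂ = 0
  mul₂₁ : p₂ * p₁ = 0
  add_eq_one : p₁ + p₂ = 1
  weight₁ : φ p₁ ≠ 0
  weight₂ : φ p₂ ≠ 0

/-- The functional `a ↦ φ (p a p) / φ p`; for `p = p_k` this is `φ_k`. -/
noncomputable def cornerState {X : Type*} [Ring X] [Algebra ℂ X]
    (φ : X →ₗ[ℂ] ℂ) (p a : X) : ℂ :=
  φ (p * a * p) / φ p

/-- The conditional expectation `E_D(a) = φ₁(p₁ a p₁) p₁ + φ₂(p₂ a p₂) p₂` onto the linear span `D`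
of `p₁` and `p₂`. -/
noncomputable def condExpD {X : Type*} [Ring X] [Algebra ℂ X]
    (φ : X →ₗ[ℂ] ℂ) (p₁ p₂ a : X) : X :=
  cornerState φ p₁ a • p₁ + cornerState φ p₂ a • p₂

/-! ### Freeness -/

/-- Freeness of a family of unital subalgebras with respect to an expectation `E`
(`E = φ` for ordinary freeness, `E = E_D` for freeness with amalgamation over `D`):
`E (x₁ ⋯ x_k) = 0` whenever all `E (x_j) = 0` and neighbouring factors come from different
subalgebras. -/
def IsFreeFamily {X M ι : Type*} [Ring X] [Algebra ℂ X] [Zero M]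
    (E : X → M) (A : ι → Subalgebra ℂ X) : Prop :=
  ∀ (k : ℕ), 1 ≤ k → ∀ (i : Fin k → ι) (x : Fin k → X),
    (∀ j, x j ∈ A (i j)) → (∀ j, E (x j) = 0) →
    (∀ j j' : Fin k, (j : ℕ) + 1 = j' → i j ≠ i j') →
    E (List.ofFn x).prod = 0

/-- Freeness of random variables in a `*`-probability space. -/
def AreFree {X ι : Type*} [Ring X] [StarRing X] [Algebra ℂ X]
    (φ : X →ₗ[ℂ] ℂ) (x : ι → X) : Prop :=
  IsFreeFamily φ fun i => Algebra.adjoin ℂ {x i, star (x i)}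

/-- Freeness, with amalgamation over `D = span {p₁, p₂}`, of rectangular random variables. -/
def AreFreeRect {X ι : Type*} [Ring X] [StarRing X] [Algebra ℂ X]
    (φ : X →ₗ[ℂ] ℂ) (p₁ p₂ : X) (x : ι → X) : Prop :=
  IsFreeFamily (condExpD φ p₁ p₂) fun i => Algebra.adjoin ℂ {p₁, p₂, x i, star (x i)}

/-! ### Non-crossing partitions -/

/-- Two different blocks never contain `a < b < c < d` with `a, c` in one and `b, d` in the
other. -/
def IsNoncrossing {n : ℕ} (π : Finpartition (Finset.univ : Finset (Fin n))) : Prop :=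
  ∀ B ∈ π.parts, ∀ C ∈ π.parts, ∀ a b c d : Fin n,
    a < b → b < c → c < d → a ∈ B → c ∈ B → b ∈ C → d ∈ C → B = C

open scoped Classical in
/-- The set `NC(n)` of non-crossing partitions of `n` ordered points. -/
noncomputable def NC (n : ℕ) : Finset (Finpartition (Finset.univ : Finset (Fin n))) :=
  Finset.univ.filter IsNoncrossing

/-- The subtuple `(a_i : i ∈ B)`, in increasing order of the indices. -/
def restrict {X : Type*} {n : ℕ} (a : Fin n → X) (B : Finset (Fin n)) : Fin B.card → X :=
  fun j => a (B.orderEmbOfFin rfl j)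

/-- For `n ≥ 1`, `NC(n)` consists of the one-block partition and of partitions all of whose blocks
have fewer than `n` elements. -/
theorem NC_top {n : ℕ} (hn : 1 ≤ n) : ∃ T ∈ NC n, T.parts = {Finset.univ} ∧
    ∀ π ∈ (NC n).erase T, ∀ B ∈ π.parts, B.card < n := by
  classical
  have : NeZero n := ⟨by omega⟩
  have hu : (Finset.univ : Finset (Fin n)) ≠ ⊥ := (Finset.univ_nonempty).ne_empty
  refine ⟨Finpartition.indiscrete hu, ?_, Finpartition.indiscrete_parts hu, ?_⟩
  · simp only [NC, Finset.mem_filter, Finset.mem_univ, true_and, IsNoncrossing,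
      Finpartition.indiscrete_parts, Finset.mem_singleton]
    rintro B rfl C rfl
    intros
    rfl
  · intro π hπ B hB
    by_contra! hc
    refine Finset.ne_of_mem_erase hπ ?_
    have hBu : B = Finset.univ := by
      rw [← Finset.card_eq_iff_eq_univ, Fintype.card_fin]
      exact le_antisymm ((Finset.card_le_univ B).trans_eq (Fintype.card_fin n)) hc
    subst hBu
    ext C
    rw [Finpartition.indiscrete_parts, Finset.mem_singleton]
    refine ⟨fun hC => ?_, fun hC => hC ▸ hB⟩
    obtain ⟨c, hc'⟩ := π.nonempty_of_mem_parts hC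
    exact π.eq_of_mem_parts hC hB hc' (Finset.mem_univ c)

theorem orderEmbOfFin_eq_cast {n : ℕ} (S : Finset (Fin n)) (hS : S = Finset.univ)
    (j : Fin S.card) :
    S.orderEmbOfFin rfl j = Fin.cast (by rw [hS, Finset.card_fin]) j := by
  have hc : S.card = n := by rw [hS, Finset.card_fin]
  have := Finset.orderEmbOfFin_unique (s := S) rfl (f := Fin.cast hc) (fun x => by simp [hS])
    (fun _ _ h => h)
  exact (congrFun this j).symm

theorem family_congr {X M : Type*} (f : (k : ℕ) → (Fin k → X) → M) {n m : ℕ} (h : m = n)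
    (a : Fin n → X) (b : Fin m → X) (hb : ∀ j, b j = a (Fin.cast h j)) : f m b = f n a := by
  subst h
  exact congrArg _ (funext hb)

/-! ### Free cumulants -/

/-- The free cumulants `κ_n(a₁, …, a_n)`, defined recursively by the moment-cumulant formula
`φ(a₁ ⋯ a_n) = ∑_{π ∈ NC(n)} ∏_{B ∈ π} κ_{|B|}(a_i : i ∈ B)` (see `moment_cumulant`): the
one-block partition is the only one with a block of size `n`, and its term is what is being
solved for. -/
noncomputable def freeCumulant {X : Type*} [Ring X] [Algebra ℂ X] (φ : X →ₗ[ℂ] ℂ)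
    (n : ℕ) (a : Fin n → X) : ℂ :=
  φ (List.ofFn a).prod - ∑ π ∈ NC n, ∏ B ∈ π.parts,
    if _h : B.card < n then freeCumulant φ B.card (restrict a B) else 0
termination_by n

/-- The moment-cumulant formula. -/
theorem moment_cumulant {X : Type*} [Ring X] [Algebra ℂ X] (φ : X →ₗ[ℂ] ℂ)
    {n : ℕ} (hn : 1 ≤ n) (a : Fin n → X) :
    φ (List.ofFn a).prod =
      ∑ π ∈ NC n, ∏ B ∈ π.parts, freeCumulant φ B.card (restrict a B) := by
  classical
  obtain ⟨T, hT, hTp, hlt⟩ := NC_top hn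
  have key := freeCumulant.eq_1 φ n a
  rw [← Finset.add_sum_erase _ _ hT] at key ⊢
  rw [hTp, Finset.prod_singleton] at key ⊢
  rw [dif_neg (by simp), zero_add] at key
  rw [family_congr (freeCumulant φ) (Finset.card_fin n) a (restrict a Finset.univ)
    (fun j => congrArg a (orderEmbOfFin_eq_cast _ rfl j)), key, eq_comm, sub_add_eq_add_sub,
    sub_eq_iff_eq_add]
  congr 1
  refine Finset.sum_congr rfl fun π hπ => Finset.prod_congr rfl fun B hB => ?_
  rw [dif_pos (hlt π hπ B hB)]

/-- Semicircular elements: `κ₂(a) > 0` and `κ_m(a, …, a) = 0` for all `m ≥ 3`. -/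
def IsSemicircular {X : Type*} [Ring X] [Algebra ℂ X] (φ : X →ₗ[ℂ] ℂ) (a : X) : Prop :=
  (∀ m, 3 ≤ m → freeCumulant φ m (fun _ => a) = 0) ∧ 0 < freeCumulant φ 2 (fun _ => a)

/-- The nested evaluation `f_π` of a family of maps `f_k` of `k` arguments along a non-crossing
partition `π`, on the arguments `a_i`, `i ∈ S`. With `V = {v₁ < ⋯ < v_k}` the block of the
smallest element of `S`, this is `f_k(a_{v₁} g₁, …, a_{v_k} g_k)`, where `g_j` is the nested
evaluation on the points of `S` between `v_j` and `v_{j+1}` (after `v_k` if `j = k`), and `1` if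
there are none. -/
noncomputable def nestedEval {X : Type*} [Ring X] (f : (k : ℕ) → (Fin k → X) → X) {n : ℕ}
    (π : Finpartition (Finset.univ : Finset (Fin n))) (a : Fin n → X) (S : Finset (Fin n)) : X :=
  if h : S.Nonempty then
    let V := π.part (S.min' h) ∩ S
    f V.card fun j =>
      a (V.orderEmbOfFin rfl j) *
        nestedEval f π a (S.filter fun t =>
          V.orderEmbOfFin rfl j < t ∧ ∀ w ∈ V, V.orderEmbOfFin rfl j < w → t < w)
  else 1
termination_by S.card
decreasing_by
  refine Finset.card_lt_card (Finset.filter_ssubset.2 ⟨V.orderEmbOfFin rfl j, ?_, fun hx => ?_⟩)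
  · exact Finset.mem_of_mem_inter_right (Finset.orderEmbOfFin_mem V rfl j)
  · exact lt_irrefl _ hx.1

/-- The operator-valued free cumulants `c_n(a₁ ⊗ ⋯ ⊗ a_n)` of a conditional expectation `E`,
defined recursively by `E(a₁ ⋯ a_n) = ∑_{π ∈ NC(n)} c_π(a₁ ⊗ ⋯ ⊗ a_n)`
(see `moment_cumulant_nested`), where `c_π` is the nested evaluation of the `c_k` along `π`; only
the one-block partition involves `c_n`, and its term is what is being solved for. -/
noncomputable def nestedCumulant {X : Type*} [Ring X] (E : X → X) (n : ℕ) (a : Fin n → X) : X :=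
  E (List.ofFn a).prod - ∑ π ∈ NC n,
    nestedEval (fun k b => if _h : k < n then nestedCumulant E k b else 0) π a Finset.univ
termination_by n

theorem nestedEval_congr {X : Type*} [Ring X] (f g : (k : ℕ) → (Fin k → X) → X) {n : ℕ}
    (π : Finpartition (Finset.univ : Finset (Fin n))) (a : Fin n → X)
    (h : ∀ B ∈ π.parts, ∀ k ≤ B.card, f k = g k) (S : Finset (Fin n)) :
    nestedEval f π a S = nestedEval g π a S := by
  induction hS : S.card using Nat.strong_induction_on generalizing S with
  | _ N ih =>
    subst hS
    rw [nestedEval.eq_1 f, nestedEval.eq_1 g]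
    split_ifs with hne
    · dsimp only
      rw [h _ (π.part_mem.2 (Finset.mem_univ (S.min' hne))) _
        (Finset.card_le_card Finset.inter_subset_left)]
      congr 1
      funext j
      congr 1
      refine ih _ (Finset.card_lt_card (Finset.filter_ssubset.2
        ⟨_, Finset.mem_of_mem_inter_right (Finset.orderEmbOfFin_mem _ rfl j),
          fun hx => lt_irrefl _ hx.1⟩)) _ rfl
    · rfl

/-- The operator-valued moment-cumulant formula. -/
theorem moment_cumulant_nested {X : Type*} [Ring X] (E : X → X)
    {n : ℕ} (hn : 1 ≤ n) (a : Fin n → X) :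
    E (List.ofFn a).prod =
      ∑ π ∈ NC n, nestedEval (nestedCumulant E) π a Finset.univ := by
  classical
  obtain ⟨T, hT, hTp, hlt⟩ := NC_top hn
  have : NeZero n := ⟨by omega⟩
  have hTe : ∀ f : (k : ℕ) → (Fin k → X) → X, nestedEval f T a Finset.univ = f n a := by
    intro f
    have hpart : ∀ i, T.part i = Finset.univ := fun i => by
      have := T.part_mem.2 (Finset.mem_univ i)
      rwa [hTp, Finset.mem_singleton] at this
    have hV : ∀ i, T.part i ∩ Finset.univ = Finset.univ := fun i => by rw [hpart]; simp
    rw [nestedEval.eq_1, dif_pos Finset.univ_nonempty]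
    refine family_congr f (by rw [hV, Finset.card_fin]) a _ fun j => ?_
    rw [orderEmbOfFin_eq_cast _ (hV _) j, nestedEval.eq_1, dif_neg, mul_one]
    rw [Finset.not_nonempty_iff_eq_empty, Finset.filter_eq_empty_iff]
    rintro t - ⟨h1, h2⟩
    exact lt_irrefl t (h2 t (by rw [hV]; exact Finset.mem_univ t) h1)
  have key := nestedCumulant.eq_1 E n a
  rw [← Finset.add_sum_erase _ _ hT] at key ⊢
  rw [hTe] at key ⊢
  rw [dif_neg (lt_irrefl n), zero_add] at key
  rw [key, eq_comm, sub_add_eq_add_sub, sub_eq_iff_eq_add]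
  congr 1
  refine Finset.sum_congr rfl fun π hπ => nestedEval_congr _ _ π a (fun B hB k hk => ?_) _
  funext b
  rw [dif_pos (hk.trans_lt (hlt π hπ B hB))]

/-- The rectangular free cumulants `κ_n`: the coefficient of `p₁` in the `D`-valued cumulants of
`E_D` (`φ₁` takes `α p₁ + β p₂` to `α`). -/
noncomputable def rectCumulant {X : Type*} [Ring X] [Algebra ℂ X]
    (φ : X →ₗ[ℂ] ℂ) (p₁ p₂ : X) (n : ℕ) (a : Fin n → X) : ℂ :=
  cornerState φ p₁ (nestedCumulant (condExpD φ p₁ p₂) n a)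

/-- Free Poisson elements: `κ_{2m}(a ⊗ a* ⊗ ⋯ ⊗ a ⊗ a*) = 0` for all `m ≥ 2`. -/
def IsFreePoisson {X : Type*} [Ring X] [StarRing X] [Algebra ℂ X]
    (φ : X →ₗ[ℂ] ℂ) (p₁ p₂ a : X) : Prop :=
  ∀ m, 2 ≤ m →
    rectCumulant φ p₁ p₂ (2 * m) (fun j => if Even (j : ℕ) then a else star a) = 0

end FreeICA

/-! Put `A = WᵀQ`, an orthogonal matrix, so that `z = Wᵀy` equals `A x`. Free cumulants are
multilinear, and a cumulant whose arguments come from different free subalgebras vanishes. Hence the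
order `n` cumulant tensors of `x` and of `z` are both diagonal: if `v_j` is the cumulant of `x_j`,
then `∑_j A_{i₁j} ⋯ A_{iₙj} v_j = 0` unless all `i_k` agree. For `n ≥ 3` and `p ≠ q`, take the
indices `(r, p, q, …, q)` and let `r` vary. The vector `w_j = A_{pj} A_{qj}^{n-2} v_j` is then
killed by `A`, so `w = 0`, and `A_{pj} A_{qj} = 0` whenever `v_j ≠ 0` (`col_mul_eq_zero_of_tensor`).
An `x_j` that is not semicircular (not free Poisson) has such a `v_j` for some `n`, so all columns
of `A` but at most one have a single nonzero entry. Orthogonality of the rows settles the remaining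
column, and `A` is a signed permutation matrix (`exists_perm_of_col`). The coefficients are real, so
the argument also applies to cumulants with some arguments starred.

The main work is the vanishing of mixed cumulants (`listCumulant_eq_zero_of_mixed`), starting from
freeness stated through moments and for a general conditional expectation `E`; the scalar setting is
`E = φ(·)1`. Splitting a non-crossing partition into the block of the first point and partitions of
its gaps expresses a moment as a sum over first blocks, each gap contributing its `E`-value
(`moment_eq_sum_markedBlocks`). For free elements the same sum restricted to blocks of one index
already gives the moment (`moment_eq_foldr_of_isFreeFamily`). Comparing the two sums, by induction
on the length, leaves exactly the mixed cumulant of full length, which must be zero.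

The restricted formula is proved by reading a word letter by letter. Each letter acts as an operator
on functions of the state (completed arguments, last letter of the block, current gap). Pairing
letters with their operators turns the claim into an identity linear in the pair, so it suffices to
check it on values of the lifted expectation and on alternating products of centred elements. There
freeness makes both sides vanish, except where everything lies in one subalgebra and the
unrestricted formula applies. -/

namespace FreeICA

/-! ### Multilinear families -/

/-- Every member of the family `f` is multilinear. -/
def IsMultilinearFamily {X : Type*} [Ring X] [Algebra ℂ X] (f : (k : ℕ) → (Fin k → X) → X) :
    Prop :=
  ∀ k, ∃ M : MultilinearMap ℂ (fun _ : Fin k => X) X, ⇑M = f k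

/-! ### The nested evaluation and its gaps -/

/-- The points of `S` after `v` and before the next point of `V`. -/
def gap {n : ℕ} (S V : Finset (Fin n)) (v : Fin n) : Finset (Fin n) :=
  S.filter fun t => v < t ∧ ∀ w ∈ V, v < w → t < w

theorem mem_gap {n : ℕ} {S V : Finset (Fin n)} {v t : Fin n} :
    t ∈ gap S V v ↔ t ∈ S ∧ v < t ∧ ∀ w ∈ V, v < w → t < w := Finset.mem_filter

theorem notMem_of_mem_gap {n : ℕ} {S V : Finset (Fin n)} {v t : Fin n} (h : t ∈ gap S V v) :
    t ∉ V := fun hV => lt_irrefl t ((mem_gap.1 h).2.2 t hV (mem_gap.1 h).2.1)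

theorem gap_unique {n : ℕ} {S V : Finset (Fin n)} {v v' t : Fin n} (hv : v ∈ V) (hv' : v' ∈ V)
    (h : t ∈ gap S V v) (h' : t ∈ gap S V v') : v = v' := by
  rw [mem_gap] at h h'
  rcases lt_trichotomy v v' with hlt | heq | hlt
  · exact absurd (h.2.2 v' hv' hlt) h'.2.1.not_gt
  · exact heq
  · exact absurd (h'.2.2 v hv hlt) h.2.1.not_gt

/-- The relevant gap is the one after the largest point of `V` below `t`; the point `m` guarantees
that there is one. -/
theorem exists_mem_gap {n : ℕ} {S V : Finset (Fin n)} {t m : Fin n} (ht : t ∈ S) (hm : m ∈ V)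
    (hmt : m ≤ t) (htV : t ∉ V) : ∃ v ∈ V, t ∈ gap S V v := by
  have hne : (V.filter (· < t)).Nonempty :=
    ⟨m, Finset.mem_filter.2 ⟨hm, lt_of_le_of_ne hmt fun h => htV (h ▸ hm)⟩⟩
  obtain ⟨h1, h2⟩ := Finset.mem_filter.1 (Finset.max'_mem _ hne)
  refine ⟨_, h1, mem_gap.2 ⟨ht, h2, fun w hw hlt => ?_⟩⟩
  by_contra hc
  have hwt : w < t := lt_of_le_of_ne (not_lt.1 hc) fun h => htV (h ▸ hw)
  exact hlt.not_ge (Finset.le_max' _ w (Finset.mem_filter.2 ⟨hw, hwt⟩))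

theorem gap_card_lt {n : ℕ} {S V : Finset (Fin n)} {v : Fin n} (hv : v ∈ S) :
    (gap S V v).card < S.card :=
  Finset.card_lt_card (Finset.filter_ssubset.2 ⟨v, hv, fun h => lt_irrefl _ h.1⟩)

theorem nestedEval_empty {X : Type*} [Ring X] (f : (k : ℕ) → (Fin k → X) → X) {n : ℕ}
    (π : Finpartition (Finset.univ : Finset (Fin n))) (a : Fin n → X) :
    nestedEval f π a ∅ = 1 := by
  rw [nestedEval.eq_1, dif_neg Finset.not_nonempty_empty]

theorem nestedEval_eq {X : Type*} [Ring X] (f : (k : ℕ) → (Fin k → X) → X) {n : ℕ}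
    (π : Finpartition (Finset.univ : Finset (Fin n))) (a : Fin n → X) {S V : Finset (Fin n)}
    (h : S.Nonempty) (hV : π.part (S.min' h) ∩ S = V) :
    nestedEval f π a S = f V.card fun j =>
      a (V.orderEmbOfFin rfl j) * nestedEval f π a (gap S V (V.orderEmbOfFin rfl j)) := by
  subst hV
  rw [nestedEval.eq_1, dif_pos h]
  rfl

/-- Evaluation along `π` on the image of an order embedding is evaluation along the pulled back
partition. -/
theorem nestedEval_map {X : Type*} [Ring X] (f : (k : ℕ) → (Fin k → X) → X) {m n : ℕ}
    (e : Fin m ↪o Fin n) (π : Finpartition (Finset.univ : Finset (Fin n)))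
    (ρ : Finpartition (Finset.univ : Finset (Fin m)))
    (h : ∀ x y, y ∈ ρ.part x ↔ e y ∈ π.part (e x)) (a : Fin n → X) (S : Finset (Fin m)) :
    nestedEval f π a (S.map e.toEmbedding) = nestedEval f ρ (a ∘ e) S := by
  induction hS : S.card using Nat.strong_induction_on generalizing S with
  | _ N ih =>
    subst hS
    rcases S.eq_empty_or_nonempty with rfl | hne
    · rw [Finset.map_empty, nestedEval_empty, nestedEval_empty]
    have hne' : (S.map e.toEmbedding).Nonempty := hne.map
    have hmin : (S.map e.toEmbedding).min' hne' = e (S.min' hne) := by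
      refine le_antisymm (Finset.min'_le _ _ (Finset.mem_map_of_mem _ (S.min'_mem hne))) ?_
      refine Finset.le_min' _ _ _ fun y hy => ?_
      obtain ⟨x, hx, rfl⟩ := Finset.mem_map.1 hy
      exact e.monotone (S.min'_le x hx)
    set V := ρ.part (S.min' hne) ∩ S with hV
    have hVS : V ⊆ S := Finset.inter_subset_right
    have hV' : π.part ((S.map e.toEmbedding).min' hne') ∩ S.map e.toEmbedding
        = V.map e.toEmbedding := by
      rw [hmin]
      ext y
      simp only [Finset.mem_inter, Finset.mem_map, hV]
      constructor
      · rintro ⟨h1, x, hx, rfl⟩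
        exact ⟨x, ⟨(h _ _).2 h1, hx⟩, rfl⟩
      · rintro ⟨x, ⟨h1, h2⟩, rfl⟩
        exact ⟨(h _ _).1 h1, x, h2, rfl⟩
    rw [nestedEval_eq f π a hne' hV', nestedEval_eq f ρ (a ∘ e) hne hV.symm]
    have hcard : (V.map e.toEmbedding).card = V.card := Finset.card_map _
    have hemb : ∀ j, (V.map e.toEmbedding).orderEmbOfFin rfl j
        = e (V.orderEmbOfFin rfl (Fin.cast hcard j)) := by
      intro j
      have := Finset.orderEmbOfFin_unique (s := V.map e.toEmbedding) rfl
        (f := fun j => e (V.orderEmbOfFin rfl (Fin.cast hcard j)))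
        (fun x => Finset.mem_map_of_mem _ (Finset.orderEmbOfFin_mem _ _ _))
        (fun x y hxy => e.strictMono ((V.orderEmbOfFin rfl).strictMono hxy))
      exact (congrFun this j).symm
    refine family_congr f hcard _ _ fun j => ?_
    rw [hemb]
    have hg : gap (S.map e.toEmbedding) (V.map e.toEmbedding)
        (e (V.orderEmbOfFin rfl (Fin.cast hcard j)))
        = (gap S V (V.orderEmbOfFin rfl (Fin.cast hcard j))).map e.toEmbedding := by
      ext y
      simp only [mem_gap, Finset.mem_map]
      constructor
      · rintro ⟨⟨x, hx, rfl⟩, h1, h2⟩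
        exact ⟨x, ⟨hx, e.lt_iff_lt.1 h1, fun w hw hlt =>
          e.lt_iff_lt.1 (h2 _ ⟨w, hw, rfl⟩ (e.lt_iff_lt.2 hlt))⟩, rfl⟩
      · rintro ⟨x, ⟨hx, h1, h2⟩, rfl⟩
        refine ⟨⟨x, hx, rfl⟩, e.lt_iff_lt.2 h1, ?_⟩
        rintro _ ⟨w, hw, rfl⟩ hlt
        exact e.lt_iff_lt.2 (h2 w hw (e.lt_iff_lt.1 hlt))
    rw [hg, ih _ (gap_card_lt (hVS (Finset.orderEmbOfFin_mem V rfl _))) _ rfl]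
    rfl

/-! ### Partitions and their blocks -/

theorem mem_part_iff {n : ℕ} (π : Finpartition (Finset.univ : Finset (Fin n))) {x y : Fin n} :
    y ∈ π.part x ↔ π.part y = π.part x :=
  π.mem_part_iff_part_eq_part (Finset.mem_univ y) (Finset.mem_univ x)

theorem mem_part_comm {n : ℕ} (π : Finpartition (Finset.univ : Finset (Fin n))) {x y : Fin n} :
    y ∈ π.part x ↔ x ∈ π.part y := by
  rw [mem_part_iff, mem_part_iff, eq_comm]

theorem mem_part_refl {n : ℕ} (π : Finpartition (Finset.univ : Finset (Fin n))) (x : Fin n) :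
    x ∈ π.part x := π.mem_part_self.2 (Finset.mem_univ x)

theorem finpartition_ext {n : ℕ} {π ρ : Finpartition (Finset.univ : Finset (Fin n))}
    (h : ∀ x y, y ∈ π.part x ↔ y ∈ ρ.part x) : π = ρ := by
  have key : ∀ x, π.part x = ρ.part x := fun x => Finset.ext fun y => h x y
  have hsub : ∀ {π ρ : Finpartition (Finset.univ : Finset (Fin n))},
      (∀ x, π.part x = ρ.part x) → π.parts ⊆ ρ.parts := by
    intro π ρ hk B hB
    obtain ⟨x, hx⟩ := π.nonempty_of_mem_parts hB
    rw [← π.part_eq_of_mem hB hx, hk]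
    exact ρ.part_mem.2 (Finset.mem_univ x)
  exact Finpartition.ext (Finset.Subset.antisymm (hsub key) (hsub fun x => (key x).symm))

theorem isNoncrossing_iff {n : ℕ} (π : Finpartition (Finset.univ : Finset (Fin n))) :
    IsNoncrossing π ↔ ∀ a b c d : Fin n, a < b → b < c → c < d → c ∈ π.part a → d ∈ π.part b →
      b ∈ π.part a := by
  constructor
  · intro h a b c d hab hbc hcd hc hd
    rw [h _ (π.part_mem.2 (Finset.mem_univ a)) _ (π.part_mem.2 (Finset.mem_univ b)) a b c d hab hbc
      hcd (mem_part_refl π a) hc (mem_part_refl π b) hd]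
    exact mem_part_refl π b
  · intro h B hB C hC a b c d hab hbc hcd ha hc hb hd
    have h1 := π.part_eq_of_mem hB ha
    have h2 := π.part_eq_of_mem hC hb
    have := h a b c d hab hbc hcd (h1 ▸ hc) (h2 ▸ hd)
    rw [h1] at this
    exact π.eq_of_mem_parts hB hC this hb

theorem mem_NC {n : ℕ} {π : Finpartition (Finset.univ : Finset (Fin n))} :
    π ∈ NC n ↔ IsNoncrossing π := by simp [NC]

open scoped Classical in
/-- The partition with blocks the classes of the equivalence relation `r`. -/
noncomputable def partitionOf {n : ℕ} (r : Setoid (Fin n)) :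
    Finpartition (Finset.univ : Finset (Fin n)) := Finpartition.ofSetoid r

theorem mem_part_partitionOf {n : ℕ} (r : Setoid (Fin n)) {x y : Fin n} :
    y ∈ (partitionOf r).part x ↔ r x y := by
  classical
  exact Finpartition.mem_part_ofSetoid_iff_rel

/-- The partition pulled back along an embedding. -/
noncomputable def comapPartition {m n : ℕ} (e : Fin m ↪o Fin n)
    (π : Finpartition (Finset.univ : Finset (Fin n))) :
    Finpartition (Finset.univ : Finset (Fin m)) :=
  partitionOf
    { r := fun x y => π.part (e x) = π.part (e y)
      iseqv := ⟨fun _ => rfl, fun h => h.symm, fun h h' => h.trans h'⟩ }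

theorem mem_part_comapPartition {m n : ℕ} (e : Fin m ↪o Fin n)
    (π : Finpartition (Finset.univ : Finset (Fin n))) (x y : Fin m) :
    y ∈ (comapPartition e π).part x ↔ e y ∈ π.part (e x) := by
  rw [comapPartition, mem_part_partitionOf, mem_part_iff]
  exact eq_comm

theorem comapPartition_mem_NC {m n : ℕ} (e : Fin m ↪o Fin n)
    {π : Finpartition (Finset.univ : Finset (Fin n))} (h : π ∈ NC n) :
    comapPartition e π ∈ NC m := by
  rw [mem_NC, isNoncrossing_iff] at *
  intro a b c d hab hbc hcd
  simp only [mem_part_comapPartition]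
  exact h _ _ _ _ (e.lt_iff_lt.2 hab) (e.lt_iff_lt.2 hbc) (e.lt_iff_lt.2 hcd)

/-! ### The first block of a non-crossing partition -/

/-- The increasing enumeration of the gap of `V` after its `j`-th point. -/
noncomputable def gapEmb {n : ℕ} (V : Finset (Fin n)) (j : Fin V.card) :
    Fin (gap Finset.univ V (V.orderEmbOfFin rfl j)).card ↪o Fin n :=
  Finset.orderEmbOfFin _ rfl

theorem gapEmb_mem {n : ℕ} (V : Finset (Fin n)) (j : Fin V.card)
    (x : Fin (gap Finset.univ V (V.orderEmbOfFin rfl j)).card) :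
    gapEmb V j x ∈ gap Finset.univ V (V.orderEmbOfFin rfl j) := Finset.orderEmbOfFin_mem _ _ _

theorem exists_gapEmb_eq_of_mem {n : ℕ} (V : Finset (Fin n)) (j : Fin V.card) {t : Fin n}
    (h : t ∈ gap Finset.univ V (V.orderEmbOfFin rfl j)) : ∃ x, gapEmb V j x = t := by
  have := Finset.range_orderEmbOfFin (gap Finset.univ V (V.orderEmbOfFin rfl j)) rfl
  exact (Set.ext_iff.1 this t).2 h

theorem exists_gapEmb_eq {n : ℕ} {V : Finset (Fin (n + 1))} (h0 : 0 ∈ V) {t : Fin (n + 1)}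
    (ht : t ∉ V) : ∃ j x, gapEmb V j x = t := by
  obtain ⟨v, hv, hg⟩ := exists_mem_gap (Finset.mem_univ t) h0 (Fin.zero_le t) ht
  obtain ⟨j, rfl⟩ : ∃ j, V.orderEmbOfFin rfl j = v :=
    (Set.ext_iff.1 (Finset.range_orderEmbOfFin V rfl) v).2 hv
  exact ⟨j, exists_gapEmb_eq_of_mem V j hg⟩

theorem gapEmb_notMem {n : ℕ} (V : Finset (Fin n)) (j : Fin V.card) (x) : gapEmb V j x ∉ V :=
  notMem_of_mem_gap (gapEmb_mem V j x)

theorem gapEmb_index_eq {n : ℕ} (V : Finset (Fin n)) {j j' : Fin V.card} {x x'}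
    (h : gapEmb V j x = gapEmb V j' x') : j = j' := by
  have h2 := gapEmb_mem V j' x'
  rw [← h] at h2
  exact (V.orderEmbOfFin rfl).injective (gap_unique (Finset.orderEmbOfFin_mem _ _ _)
    (Finset.orderEmbOfFin_mem _ _ _) (gapEmb_mem V j x) h2)

/-- Two points of different gaps are separated by a point of `V`. -/
theorem exists_mem_between {n : ℕ} {S V : Finset (Fin n)} {v v' t t' : Fin n}
    (hv' : v' ∈ V) (h : t ∈ gap S V v) (h' : t' ∈ gap S V v') (hlt : t < t')
    (hne : v ≠ v') (hv : v ∈ V) : t < v' ∧ v' < t' := by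
  rw [mem_gap] at h h'
  refine ⟨?_, h'.2.1⟩
  rcases lt_or_gt_of_ne hne with h1 | h1
  · exact h.2.2 _ hv' h1
  · exact absurd (h'.2.2 v hv h1) (not_lt.2 (h.2.1.trans hlt).le)

/-- In a non-crossing partition the block of a point in a gap of the first block stays in the
gap. -/
theorem mem_gap_of_mem_part {n : ℕ} {π : Finpartition (Finset.univ : Finset (Fin n))}
    (hπ : IsNoncrossing π) {S V : Finset (Fin n)} {m : Fin n} (hV : π.part m ∩ S = V)
    (hm : m ∈ S) (hmin : ∀ t ∈ S, m ≤ t) {v t t' : Fin n} (hv : v ∈ V)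
    (ht : t ∈ gap S V v) (ht'S : t' ∈ S) (ht' : t' ∈ π.part t) : t' ∈ gap S V v := by
  rw [isNoncrossing_iff] at hπ
  have hmV : m ∈ V := hV ▸ Finset.mem_inter.2 ⟨mem_part_refl π m, hm⟩
  have hVm : ∀ w ∈ V, w ∈ π.part m ∧ w ∈ S := fun w hw => by
    rwa [← hV, Finset.mem_inter] at hw
  have htV := notMem_of_mem_gap ht
  have htS := (mem_gap.1 ht).1
  have hnot : ∀ s ∈ S, s ∉ V → s ∉ π.part m := fun s hs hsV h =>
    hsV (hV ▸ Finset.mem_inter.2 ⟨h, hs⟩)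
  have ht'V : t' ∉ V := fun h => by
    have h1 := (hVm _ h).1
    rw [mem_part_iff] at h1 ht'
    exact hnot t htS htV ((mem_part_iff π).2 (ht'.symm.trans h1))
  obtain ⟨v', hv', hg'⟩ := exists_mem_gap ht'S hmV (hmin t' ht'S) ht'V
  by_contra hc
  have hne : v ≠ v' := fun h => hc (h ▸ hg')
  rcases lt_trichotomy t t' with hlt | heq | hlt
  · obtain ⟨h1, h2⟩ := exists_mem_between hv' ht hg' hlt hne hv
    refine hnot t htS htV (hπ m t v' t' ?_ h1 h2 (hVm _ hv').1 ht')
    exact lt_of_le_of_ne (hmin t htS) fun h => htV (h ▸ hmV)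
  · exact hc (heq ▸ ht)
  · obtain ⟨h1, h2⟩ := exists_mem_between hv hg' ht hlt hne.symm hv'
    refine hnot t' ht'S ht'V (hπ m t' v t ?_ h1 h2 (hVm _ hv).1 ((mem_part_comm π).1 ht'))
    exact lt_of_le_of_ne (hmin t' ht'S) fun h => ht'V (h ▸ hmV)

/-- The partition with block `V` and the partitions `r j` on the gaps of `V`. -/
noncomputable def gluePartition {n : ℕ} (V : Finset (Fin n))
    (r : ∀ j : Fin V.card, Finpartition
      (Finset.univ : Finset (Fin (gap Finset.univ V (V.orderEmbOfFin rfl j)).card))) :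
    Finpartition (Finset.univ : Finset (Fin n)) :=
  partitionOf
    { r := fun x y => x = y ∨ (x ∈ V ∧ y ∈ V) ∨
        ∃ j x' y', gapEmb V j x' = x ∧ gapEmb V j y' = y ∧ y' ∈ (r j).part x'
      iseqv := by
        refine ⟨fun _ => Or.inl rfl, ?_, ?_⟩
        · rintro x y (h | h | ⟨j, x', y', h1, h2, h3⟩)
          · exact Or.inl h.symm
          · exact Or.inr (Or.inl h.symm)
          · exact Or.inr (Or.inr ⟨j, y', x', h2, h1, (mem_part_comm _).1 h3⟩)
        · rintro x y z (rfl | h | ⟨j, x', y', rfl, rfl, h3⟩)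
          · exact id
          · rintro (rfl | h' | ⟨j, x', y', h1, h2, h3⟩)
            · exact Or.inr (Or.inl h)
            · exact Or.inr (Or.inl ⟨h.1, h'.2⟩)
            · exact absurd (h1 ▸ h.2) (gapEmb_notMem V j x')
          · rintro (rfl | h' | ⟨j', x'', y'', h1, rfl, h3'⟩)
            · exact Or.inr (Or.inr ⟨j, x', y', rfl, rfl, h3⟩)
            · exact absurd h'.1 (gapEmb_notMem V j y')
            · obtain rfl := gapEmb_index_eq V h1
              obtain rfl := (gapEmb V _).injective h1
              refine Or.inr (Or.inr ⟨_, x', y'', rfl, rfl, ?_⟩)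
              rw [mem_part_iff] at *
              exact h3'.trans h3 }

theorem part_zero_gluePartition {n : ℕ} {V : Finset (Fin (n + 1))} (h0 : 0 ∈ V) (r) :
    (gluePartition V r).part 0 = V := by
  ext y
  rw [gluePartition, mem_part_partitionOf]
  constructor
  · rintro (h | h | ⟨j, x', y', h1, -, -⟩)
    · exact h ▸ h0
    · exact h.2
    · exact absurd (h1 ▸ h0) (gapEmb_notMem V j x')
  · exact fun hy => Or.inr (Or.inl ⟨h0, hy⟩)

theorem comapPartition_gluePartition {n : ℕ} (V : Finset (Fin n)) (r) (j : Fin V.card) :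
    comapPartition (gapEmb V j) (gluePartition V r) = r j := by
  refine finpartition_ext fun x y => ?_
  rw [mem_part_comapPartition, gluePartition, mem_part_partitionOf]
  constructor
  · rintro (h | h | ⟨j', x', y', h1, h2, h3⟩)
    · rw [(gapEmb V j).injective h]
      exact mem_part_refl _ _
    · exact absurd h.1 (gapEmb_notMem V j x)
    · obtain rfl := gapEmb_index_eq V h1
      obtain rfl := (gapEmb V _).injective h1
      obtain rfl := (gapEmb V _).injective h2
      exact h3
  · exact fun h => Or.inr (Or.inr ⟨j, x, y, rfl, rfl, h⟩)

/-- This is where non-crossing is needed for the first block decomposition: no block can link two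
gaps of `V`, so nothing is lost by restricting to the gaps. -/
theorem gluePartition_comapPartition {n : ℕ} {V : Finset (Fin (n + 1))}
    {π : Finpartition (Finset.univ : Finset (Fin (n + 1)))} (hπ : π ∈ NC (n + 1))
    (hV : π.part 0 = V) :
    gluePartition V (fun j => comapPartition (gapEmb V j) π) = π := by
  have h0 : 0 ∈ V := hV ▸ mem_part_refl π 0
  refine finpartition_ext fun x y => ?_
  rw [gluePartition, mem_part_partitionOf]
  constructor
  · rintro (rfl | ⟨h, h'⟩ | ⟨j, x', y', rfl, rfl, h⟩)
    · exact mem_part_refl _ _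
    · rw [← hV, mem_part_iff] at h h'
      rw [mem_part_iff, h, h']
    · exact (mem_part_comapPartition _ _ _ _).1 h
  · intro h
    by_cases hx : x ∈ V
    · refine Or.inr (Or.inl ⟨hx, ?_⟩)
      rw [← hV, mem_part_iff] at hx ⊢
      rw [mem_part_iff] at h
      exact h.trans hx
    · obtain ⟨j, x', rfl⟩ := exists_gapEmb_eq h0 hx
      have := mem_gap_of_mem_part (mem_NC.1 hπ) (S := Finset.univ) (by rw [hV]; simp)
        (Finset.mem_univ 0) (fun t _ => Fin.zero_le t) (Finset.orderEmbOfFin_mem V rfl j)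
        (gapEmb_mem V j x') (Finset.mem_univ y) h
      obtain ⟨y', rfl⟩ := exists_gapEmb_eq_of_mem V j this
      exact Or.inr (Or.inr ⟨j, x', y', rfl, rfl, (mem_part_comapPartition _ _ _ _).2 h⟩)

/-- A crossing inside one gap is excluded by `r j`. Any other crossing would have a block leave its
gap and return, although gaps are intervals between consecutive points of `V`. -/
theorem gluePartition_mem_NC {n : ℕ} {V : Finset (Fin (n + 1))}
    {r : ∀ j : Fin V.card, Finpartition
      (Finset.univ : Finset (Fin (gap Finset.univ V (V.orderEmbOfFin rfl j)).card))}
    (hr : ∀ j, r j ∈ NC _) : gluePartition V r ∈ NC (n + 1) := by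
  rw [mem_NC, isNoncrossing_iff]
  intro a b c d hab hbc hcd
  simp only [gluePartition, mem_part_partitionOf]
  rintro (rfl | h | ⟨j, x, y, rfl, rfl, h⟩) (rfl | h' | ⟨j', x', y', rfl, rfl, h'⟩)
  · exact absurd (hab.trans hbc) (lt_irrefl _)
  · exact absurd (hab.trans hbc) (lt_irrefl _)
  · exact absurd (hab.trans hbc) (lt_irrefl _)
  · exact absurd (hbc.trans hcd) (lt_irrefl _)
  · exact Or.inr (Or.inl ⟨h.1, h'.1⟩)
  · have h1 := mem_gap.1 (gapEmb_mem V j' x')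
    have h2 := mem_gap.1 (gapEmb_mem V j' y')
    exact absurd (h2.2.2 c h.2 (h1.2.1.trans hbc)) hcd.not_gt
  · exact absurd (hbc.trans hcd) (lt_irrefl _)
  · have h1 := mem_gap.1 (gapEmb_mem V j x)
    have h2 := mem_gap.1 (gapEmb_mem V j y)
    exact absurd (h2.2.2 b h'.1 (h1.2.1.trans hab)) hbc.not_gt
  · by_cases hj : j = j'
    · subst hj
      have := (isNoncrossing_iff _).1 (mem_NC.1 (hr j)) x x' y y'
        ((gapEmb V j).lt_iff_lt.1 hab) ((gapEmb V j).lt_iff_lt.1 hbc) ((gapEmb V j).lt_iff_lt.1 hcd)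
        h h'
      exact Or.inr (Or.inr ⟨j, x, x', rfl, rfl, this⟩)
    · have hne : V.orderEmbOfFin rfl j ≠ V.orderEmbOfFin rfl j' :=
        fun h => hj ((V.orderEmbOfFin rfl).injective h)
      have h1 := exists_mem_between (Finset.orderEmbOfFin_mem V rfl j') (gapEmb_mem V j x)
        (gapEmb_mem V j' x') hab hne (Finset.orderEmbOfFin_mem V rfl j)
      have h2 := exists_mem_between (Finset.orderEmbOfFin_mem V rfl j) (gapEmb_mem V j' x')
        (gapEmb_mem V j y) hbc hne.symm (Finset.orderEmbOfFin_mem V rfl j')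
      have h3 := (mem_gap.1 (gapEmb_mem V j x)).2.1
      exact absurd (h3.trans hab) (not_lt.2 h2.1.le)

/-- The decomposition of a sum over `NC (n + 1)` according to the block of the first point. -/
theorem sum_NC_nestedEval {X : Type*} [Ring X] [Algebra ℂ X] {f : (k : ℕ) → (Fin k → X) → X}
    (hf : IsMultilinearFamily f) {n : ℕ} (a : Fin (n + 1) → X) :
    ∑ π ∈ NC (n + 1), nestedEval f π a Finset.univ =
      ∑ V : Finset (Fin (n + 1)) with 0 ∈ V, f V.card fun j => a (V.orderEmbOfFin rfl j) *
        ∑ ρ ∈ NC (gap Finset.univ V (V.orderEmbOfFin rfl j)).card,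
          nestedEval f ρ (a ∘ gapEmb V j) Finset.univ := by
  classical
  rw [← Finset.sum_fiberwise_of_maps_to (s := NC (n + 1)) (t := Finset.univ.filter (0 ∈ ·))
    (g := fun π => π.part 0) fun π _ => Finset.mem_filter.2 ⟨Finset.mem_univ _, mem_part_refl π 0⟩]
  refine Finset.sum_congr rfl fun V hV => ?_
  have h0 : 0 ∈ V := (Finset.mem_filter.1 hV).2
  obtain ⟨M, hM⟩ := hf V.card
  simp only [← hM, Finset.mul_sum]
  rw [M.map_sum_finset]
  refine Finset.sum_bij' (fun π _ j => comapPartition (gapEmb V j) π)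
    (fun r _ => gluePartition V r) ?_ ?_ ?_ ?_ ?_
  · intro π hπ
    exact Fintype.mem_piFinset.2 fun j => comapPartition_mem_NC _ (Finset.mem_filter.1 hπ).1
  · intro r hr
    exact Finset.mem_filter.2 ⟨gluePartition_mem_NC (Fintype.mem_piFinset.1 hr),
      part_zero_gluePartition h0 r⟩
  · intro π hπ
    exact gluePartition_comapPartition (Finset.mem_filter.1 hπ).1 (Finset.mem_filter.1 hπ).2
  · intro r _
    exact funext fun j => comapPartition_gluePartition V r j
  · intro π hπ
    have hne : (Finset.univ : Finset (Fin (n + 1))).Nonempty := Finset.univ_nonempty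
    have hmin : (Finset.univ : Finset (Fin (n + 1))).min' hne = 0 :=
      le_antisymm (Finset.min'_le _ _ (Finset.mem_univ _)) (Fin.zero_le _)
    rw [nestedEval_eq f π a hne (V := V)
      (by rw [hmin, (Finset.mem_filter.1 hπ).2, Finset.inter_univ]), hM]
    congr 1
    funext j
    congr 1
    rw [← nestedEval_map f (gapEmb V j) π _ (mem_part_comapPartition _ _) a]
    congr 1
    exact (Finset.map_orderEmbOfFin_univ _ rfl).symm

/-! ### Multilinearity of cumulants -/

theorem nestedEval_congr_on {X : Type*} [Ring X] (f : (k : ℕ) → (Fin k → X) → X) {n : ℕ}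
    (π : Finpartition (Finset.univ : Finset (Fin n))) {a b : Fin n → X} (S : Finset (Fin n))
    (h : ∀ t ∈ S, a t = b t) : nestedEval f π a S = nestedEval f π b S := by
  induction hS : S.card using Nat.strong_induction_on generalizing S with
  | _ N ih =>
    subst hS
    rcases S.eq_empty_or_nonempty with rfl | hne
    · rw [nestedEval_empty, nestedEval_empty]
    rw [nestedEval_eq f π a hne rfl, nestedEval_eq f π b hne rfl]
    congr 1
    funext j
    have hj := Finset.mem_of_mem_inter_right
      (Finset.orderEmbOfFin_mem (π.part (S.min' hne) ∩ S) rfl j)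
    rw [h _ hj, ih _ (gap_card_lt hj) _ (fun t ht => h t (mem_gap.1 ht).1) rfl]

theorem exists_orderEmbOfFin_eq {n : ℕ} {V : Finset (Fin n)} {v : Fin n} (hv : v ∈ V) :
    ∃ j, V.orderEmbOfFin rfl j = v :=
  (Set.ext_iff.1 (Finset.range_orderEmbOfFin V rfl) v).2 hv

/-- The letter at `t` enters exactly one argument of the outer map: directly if `t` lies in the
first block, and otherwise through the unique gap containing `t`, where induction applies. -/
theorem nestedEval_linear {X : Type*} [Ring X] [Algebra ℂ X] {f : (k : ℕ) → (Fin k → X) → X}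
    (hf : IsMultilinearFamily f) {n : ℕ} (π : Finpartition (Finset.univ : Finset (Fin n)))
    (a : Fin n → X) {S : Finset (Fin n)} {t : Fin n} (ht : t ∈ S) :
    ∃ L : X →ₗ[ℂ] X, ∀ x, nestedEval f π (Function.update a t x) S = L x := by
  induction hS : S.card using Nat.strong_induction_on generalizing S with
  | _ N ih =>
    subst hS
    have hne : S.Nonempty := ⟨t, ht⟩
    obtain ⟨V, hV⟩ : ∃ V, π.part (S.min' hne) ∩ S = V := ⟨_, rfl⟩
    have hVS : V ⊆ S := hV ▸ Finset.inter_subset_right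
    obtain ⟨M, hM⟩ := hf V.card
    have hmV : S.min' hne ∈ V := hV ▸ Finset.mem_inter.2 ⟨mem_part_refl π _, S.min'_mem hne⟩
    by_cases htV : t ∈ V
    · obtain ⟨j, hj⟩ := exists_orderEmbOfFin_eq htV
      refine ⟨(M.toLinearMap (fun i => a (V.orderEmbOfFin rfl i) *
        nestedEval f π a (gap S V (V.orderEmbOfFin rfl i))) j) ∘ₗ
        LinearMap.mulRight ℂ (nestedEval f π a (gap S V t)), fun x => ?_⟩
      rw [nestedEval_eq f π _ hne hV, ← hM]
      simp only [LinearMap.comp_apply, MultilinearMap.toLinearMap_apply, LinearMap.mulRight_apply]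
      congr 1
      funext i
      rw [nestedEval_congr_on f π (b := a) _ fun s hs => Function.update_of_ne
        (by rintro rfl; exact notMem_of_mem_gap hs htV) _ _]
      by_cases hi : i = j
      · subst hi
        rw [hj, Function.update_self, Function.update_self]
      · rw [Function.update_of_ne hi, Function.update_of_ne]
        exact fun h => hi ((V.orderEmbOfFin rfl).injective (h.trans hj.symm))
    · obtain ⟨v, hv, hg⟩ := exists_mem_gap ht hmV (S.min'_le t ht) htV
      obtain ⟨j, hj⟩ := exists_orderEmbOfFin_eq hv
      obtain ⟨L, hL⟩ := ih _ (gap_card_lt (hVS hv)) hg rfl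
      refine ⟨(M.toLinearMap (fun i => a (V.orderEmbOfFin rfl i) *
        nestedEval f π a (gap S V (V.orderEmbOfFin rfl i))) j) ∘ₗ
        LinearMap.mulLeft ℂ (a v) ∘ₗ L, fun x => ?_⟩
      rw [nestedEval_eq f π _ hne hV, ← hM]
      simp only [LinearMap.comp_apply, MultilinearMap.toLinearMap_apply, LinearMap.mulLeft_apply]
      congr 1
      funext i
      have hi' := Finset.orderEmbOfFin_mem V rfl i
      rw [Function.update_of_ne (by rintro h; exact htV (h ▸ hi'))]
      by_cases hi : i = j
      · subst hi
        rw [hj, Function.update_self, hL]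
      · rw [Function.update_of_ne hi, nestedEval_congr_on f π (b := a)]
        intro s hs
        refine Function.update_of_ne (fun h => hi ?_) _ _
        subst h
        exact (V.orderEmbOfFin rfl).injective ((gap_unique hi' hv hs hg).trans hj.symm)

theorem nestedEval_multilinear {X : Type*} [Ring X] [Algebra ℂ X]
    {f : (k : ℕ) → (Fin k → X) → X} (hf : IsMultilinearFamily f) {n : ℕ}
    (π : Finpartition (Finset.univ : Finset (Fin n))) :
    ∃ M : MultilinearMap ℂ (fun _ : Fin n => X) X,
      ⇑M = fun a => nestedEval f π a Finset.univ := by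
  refine ⟨MultilinearMap.mk' _ (fun a t x y => ?_) (fun a t c x => ?_), rfl⟩
  · obtain ⟨L, hL⟩ := nestedEval_linear hf π a (Finset.mem_univ t)
    simp only [hL, map_add]
  · obtain ⟨L, hL⟩ := nestedEval_linear hf π a (Finset.mem_univ t)
    simp only [hL, map_smul]

theorem isMultilinearFamily_truncate {X : Type*} [Ring X] [Algebra ℂ X]
    {f : (k : ℕ) → (Fin k → X) → X} {n : ℕ}
    (hf : ∀ k < n, ∃ M : MultilinearMap ℂ (fun _ : Fin k => X) X, ⇑M = f k) :
    IsMultilinearFamily (fun k (b : Fin k → X) => if _h : k < n then f k b else 0) := by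
  intro k
  by_cases hk : k < n
  · obtain ⟨M, hM⟩ := hf k hk
    exact ⟨M, by funext b; simp [hM, hk]⟩
  · exact ⟨0, by funext b; simp [hk]⟩

/-- The recursion writes the cumulant as a multilinear moment minus nested evaluations of cumulants
of smaller order. -/
theorem nestedCumulant_multilinear {X : Type*} [Ring X] [Algebra ℂ X] (E : X →ₗ[ℂ] X) :
    IsMultilinearFamily (nestedCumulant E) := by
  intro n
  induction n using Nat.strong_induction_on with
  | _ n ih =>
    have hf := isMultilinearFamily_truncate ih
    choose M hM using fun π => nestedEval_multilinear hf (n := n) π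
    refine ⟨E.compMultilinearMap (MultilinearMap.mkPiAlgebraFin ℂ n X) - ∑ π ∈ NC n, M π, ?_⟩
    funext a
    rw [nestedCumulant.eq_1, sub_apply, sum_apply,
      LinearMap.compMultilinearMap_apply, MultilinearMap.mkPiAlgebraFin_apply]
    simp only [hM]

/-! ### Marked words -/

/-- A marked word splits into the product of its letters before the first mark, and the list of
the elements `a * E g` for a marked letter `a` followed by the unmarked letters with product `g`. -/
def markedBlocks {X : Type*} [Ring X] (E : X → X) : List (Bool × X) → X × List X
  | [] => (1, [])
  | (true, a) :: w => (1, (a * E (markedBlocks E w).1) :: (markedBlocks E w).2)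
  | (false, a) :: w => (a * (markedBlocks E w).1, (markedBlocks E w).2)

/-- The marked word with letters `a` and marks `p`. -/
def markedWord {X : Type*} {n : ℕ} (p : Fin n → Bool) (a : Fin n → X) : List (Bool × X) :=
  List.ofFn fun t => (p t, a t)

open scoped Classical in
theorem markedBlocks_markedWord {X : Type*} [Ring X] (E : X → X) {n : ℕ} (p : Fin n → Bool)
    (a : Fin n → X) :
    markedBlocks E (markedWord p a) =
      ((((List.finRange n).filter fun t => ∀ v, p v → t < v).map a).prod,
      ((List.finRange n).filter p).map fun v => a v *
        E (((List.finRange n).filter fun t => v < t ∧ ∀ w, p w → v < w → t < w).map a).prod) := by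
  induction n with
  | zero => simp [markedWord, markedBlocks]
  | succ n ih =>
    have hw : markedWord p a
        = (p 0, a 0) :: markedWord (fun t => p t.succ) (fun t => a t.succ) := by
      simp [markedWord, List.ofFn_succ]
    rw [hw]
    have hgap : ∀ v : Fin n, ((List.finRange (n + 1)).filter
          fun t => v.succ < t ∧ ∀ w, p w → v.succ < w → t < w).map a =
        ((List.finRange n).filter
          fun t => v < t ∧ ∀ w, p w.succ → v < w → t < w).map (fun t => a t.succ) := by
      intro v
      rw [List.finRange_succ, List.filter_cons_of_neg (by simp), List.filter_map, List.map_map]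
      congr 1
      refine List.filter_congr fun t _ => ?_
      simp [Fin.forall_fin_succ]
    cases h0 : p 0 with
    | true =>
      rw [markedBlocks, ih, Prod.mk.injEq]
      refine ⟨?_, ?_⟩
      · rw [List.filter_eq_nil_iff.2]
        · rfl
        · intro t _ ht
          exact absurd ((of_decide_eq_true ht) 0 h0) (Fin.not_lt_zero t)
      · dsimp only
        rw [List.finRange_succ, List.filter_cons_of_pos h0, ← List.finRange_succ, List.map_cons,
          List.filter_map, List.map_map]
        congr 1
        · congr 3
          rw [List.finRange_succ, List.filter_cons_of_neg (by simp), List.filter_map,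
            List.map_map]
          congr 1
          refine List.filter_congr fun t _ => ?_
          simp [Fin.forall_fin_succ]
        · refine List.map_congr_left fun v _ => ?_
          simp only [Function.comp_apply, hgap]
    | false =>
      rw [markedBlocks, ih, Prod.mk.injEq]
      refine ⟨?_, ?_⟩
      · dsimp only
        rw [List.finRange_succ, List.filter_cons_of_pos, List.map_cons, List.prod_cons,
          List.filter_map, List.map_map]
        · congr 3
          refine List.filter_congr fun t _ => ?_
          simp [Fin.forall_fin_succ, h0]
        · simp only [decide_eq_true_eq]
          intro v hv
          exact Fin.pos_iff_ne_zero.2 fun h => by simp [h, h0] at hv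
      · dsimp only
        rw [List.finRange_succ, List.filter_cons_of_neg (by simp [h0]), ← List.finRange_succ,
          List.filter_map, List.map_map]
        refine List.map_congr_left fun v _ => ?_
        simp only [Function.comp_apply, hgap]

/-! ### The first block formula on lists -/

/-- The cumulants of `E` as a function of lists. -/
noncomputable def listCumulant {X : Type*} [Ring X] (E : X → X) (l : List X) : X :=
  nestedCumulant E l.length l.get

theorem nestedCumulant_eq_listCumulant {X : Type*} [Ring X] (E : X → X) {k : ℕ} (b : Fin k → X) :
    nestedCumulant E k b = listCumulant E (List.ofFn b) :=
  (family_congr (nestedCumulant E) List.length_ofFn b (List.ofFn b).get fun j => by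
    rw [List.get_ofFn]).symm

theorem sort_eq_filter_finRange {n : ℕ} (V : Finset (Fin n)) :
    V.sort = (List.finRange n).filter (· ∈ V) := by
  have hV : ((List.finRange n).filter (· ∈ V)).toFinset = V := by
    ext; simp
  conv_lhs => rw [← hV]
  rw [List.toFinset_sort _ ((List.nodup_finRange n).filter _)]
  exact ((List.pairwise_lt_finRange n).imp le_of_lt).filter _

theorem ofFn_comp_orderEmbOfFin {X : Type*} {n : ℕ} (V : Finset (Fin n)) (h : Fin n → X) :
    List.ofFn (fun j => h (V.orderEmbOfFin rfl j)) = ((List.finRange n).filter (· ∈ V)).map h := by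
  rw [← sort_eq_filter_finRange, ← Finset.listMap_orderEmbOfFin_finRange V rfl, List.map_map,
    List.ofFn_eq_map]
  rfl

/-- The moment of a word, expanded along the block of its first letter. -/
theorem moment_eq_sum_markedBlocks {X : Type*} [Ring X] [Algebra ℂ X] (E : X →ₗ[ℂ] X)
    (hE : E 1 = 1) {n : ℕ} (a : Fin (n + 1) → X) :
    E (List.ofFn a).prod = ∑ V : Finset (Fin (n + 1)) with 0 ∈ V,
      listCumulant E (markedBlocks E (markedWord (fun t => decide (t ∈ V)) a)).2 := by
  classical
  rw [moment_cumulant_nested E (by omega) a, sum_NC_nestedEval (nestedCumulant_multilinear E)]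
  refine Finset.sum_congr rfl fun V _ => ?_
  have hg : ∀ j : Fin V.card,
      ∑ ρ ∈ NC (gap Finset.univ V (V.orderEmbOfFin rfl j)).card,
        nestedEval (nestedCumulant E) ρ (a ∘ gapEmb V j) Finset.univ =
      E (List.ofFn (a ∘ gapEmb V j)).prod := by
    intro j
    -- The moment-cumulant formula needs a nonempty word. For an empty gap, `NC 0` has one element,
    -- whose evaluation is `1 = E 1`.
    rcases Nat.eq_zero_or_pos (gap Finset.univ V (V.orderEmbOfFin rfl j)).card with h | h
    · generalize gapEmb V j = e
      revert e
      rw [h]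
      intro e
      have : NC 0 = {⊥} := by
        refine Finset.eq_singleton_iff_unique_mem.2 ⟨mem_NC.2 fun _ _ _ _ a => a.elim0, ?_⟩
        exact fun π _ => finpartition_ext fun x => x.elim0
      rw [this, Finset.sum_singleton, List.ofFn_zero, List.prod_nil, hE]
      exact nestedEval_empty _ _ _
    · exact (moment_cumulant_nested E h _).symm
  simp only [hg]
  rw [nestedCumulant_eq_listCumulant, markedBlocks_markedWord]
  congr 1
  have := ofFn_comp_orderEmbOfFin V fun v => a v * E (((List.finRange (n + 1)).filter
    (· ∈ gap Finset.univ V v)).map a).prod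
  simp only [mem_gap, Finset.mem_univ, true_and] at this
  simp only [decide_eq_true_eq]
  rw [← this]
  congr 1
  funext j
  congr 2
  have := ofFn_comp_orderEmbOfFin (gap Finset.univ V (V.orderEmbOfFin rfl j)) a
  simp only [mem_gap, Finset.mem_univ, true_and] at this
  rw [← this]
  rfl

/-- A letter `a` is either appended to the current gap `g` or, if `J` holds, joins the block that
is being built; `u` are the completed arguments of the block and `b` is its last letter. -/
def readLetter {X M : Type*} [Ring X] [AddCommGroup M] (E : X → X) (J : Bool) (a : X)
    (Φ : List X → X → X → M) (u : List X) (b g : X) : M :=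
  Φ u b (g * a) + if J then Φ (u ++ [b * E g]) a 1 else 0

/-- The value of a completed block. -/
noncomputable def closeBlock {X : Type*} [Ring X] (E : X → X) (u : List X) (b g : X) : X :=
  listCumulant E (u ++ [b * E g])

/-- Each letter offers a choice between prolonging the gap and joining the block; the marks `p`
record these choices. -/
theorem foldr_readLetter_eq_sum {X : Type*} [Ring X] (E : X → X) {n : ℕ} (a : Fin n → X)
    (u : List X) (b g : X) :
    (List.ofFn a).foldr (readLetter E true) (closeBlock E) u b g =
      ∑ p : Fin n → Bool, listCumulant E
        (u ++ (b * E (g * (markedBlocks E (markedWord p a)).1)) ::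
          (markedBlocks E (markedWord p a)).2) := by
  induction n generalizing u b g with
  | zero => simp [markedWord, markedBlocks, closeBlock]
  | succ n ih =>
    rw [List.ofFn_succ, List.foldr_cons, readLetter, ih, if_pos rfl, ih,
      ← (Fin.consEquiv fun _ => Bool).sum_comp, Fintype.sum_prod_type, Fintype.sum_bool, add_comm]
    have hw : ∀ c p, markedWord ((Fin.consEquiv fun _ => Bool) (c, p)) a
        = (c, a 0) :: markedWord p (fun t => a t.succ) := by
      intro c p
      simp [markedWord, List.ofFn_succ, Fin.consEquiv]
    congr 1
    · refine Finset.sum_congr rfl fun p _ => ?_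
      rw [hw, markedBlocks]
      simp
    · refine Finset.sum_congr rfl fun p _ => ?_
      rw [hw, markedBlocks]
      simp [mul_assoc]

/-- The first block formula in sequential form: the block starts with `a`, and the marked later
letters are its other points. -/
theorem moment_eq_foldr {X : Type*} [Ring X] [Algebra ℂ X] (E : X →ₗ[ℂ] X)
    (hE : E 1 = 1) (a : X) (w : List X) :
    E (a * w.prod) = w.foldr (readLetter E true) (closeBlock E) [] a 1 := by
  classical
  obtain ⟨n, w, rfl⟩ : ∃ (n : ℕ) (f : Fin n → X), w = List.ofFn f :=
    ⟨w.length, w.get, (List.ofFn_get w).symm⟩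
  have := moment_eq_sum_markedBlocks E hE (Fin.cons a w : Fin (n + 1) → X)
  rw [List.ofFn_succ, List.prod_cons] at this
  simp only [Fin.cons_zero, Fin.cons_succ] at this
  rw [this, foldr_readLetter_eq_sum]
  refine Finset.sum_bij' (fun V _ i => decide (i.succ ∈ V))
    (fun p _ => Finset.univ.filter fun i => Fin.cons (α := fun _ => Bool) true p i = true)
    ?_ ?_ ?_ ?_ ?_
  · simp
  · simp
  · intro V hV
    have h0 := (Finset.mem_filter.1 hV).2
    ext i
    refine Fin.cases ?_ (fun i => ?_) i <;> simp [h0]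
  · intro p _
    funext i
    simp
  · intro V hV
    have h0 := (Finset.mem_filter.1 hV).2
    have hw : markedWord (fun t => decide (t ∈ V)) (Fin.cons a w : Fin (n + 1) → X)
        = (true, a) :: markedWord (fun i => decide (i.succ ∈ V)) w := by
      simp [markedWord, List.ofFn_succ, h0]
    rw [hw, markedBlocks]
    simp

/-! ### Conditional expectations and alternating products -/

/-- The properties of a conditional expectation onto its range that are needed for cumulants. -/
structure IsCondExp {X : Type*} [Ring X] [Algebra ℂ X] (E : X →ₗ[ℂ] X) : Prop where
  map_one : E 1 = 1
  map_left : ∀ a b, E (E a * b) = E a * E b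
  map_right : ∀ a b, E (a * E b) = E a * E b

namespace IsCondExp

variable {X : Type*} [Ring X] [Algebra ℂ X] {E : X →ₗ[ℂ] X}

theorem map_map (hE : IsCondExp E) (a : X) : E (E a) = E a := by
  simpa [hE.map_one] using hE.map_right 1 a

theorem map_sub_map (hE : IsCondExp E) (a : X) : E (a - E a) = 0 := by
  rw [map_sub, hE.map_map, sub_self]

end IsCondExp

/-- Products `t₁ ⋯ t_k`, `k ≥ 1`, of elements satisfying `z`, whose neighbouring factors come from
different members of the family `T`; the first one comes from the member with the given index. -/
inductive IsAlternating {ι B : Type*} [Mul B] (T : ι → Set B) (z : B → Prop) : ι → B → Prop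
  | single {c : ι} {t : B} : t ∈ T c → z t → IsAlternating T z c t
  | cons {c c' : ι} {t s : B} : t ∈ T c → z t → c ≠ c' → IsAlternating T z c' s →
      IsAlternating T z c (t * s)

theorem IsAlternating.map {ι B B' : Type*} [Mul B] [Mul B'] {T : ι → Set B} {T' : ι → Set B'}
    {z : B → Prop} {z' : B' → Prop} (f : B →ₙ* B') (hT : ∀ c, ∀ t ∈ T c, f t ∈ T' c)
    (hz : ∀ t, z t → z' (f t)) {c : ι} {s : B} (h : IsAlternating T z c s) :
    IsAlternating T' z' c (f s) := by
  induction h with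
  | single h1 h2 => exact .single (hT _ _ h1) (hz _ h2)
  | cons h1 h2 h3 _ ih =>
    rw [map_mul]
    exact .cons (hT _ _ h1) (hz _ h2) h3 ih

section Freeness

variable {X ι : Type*} [Ring X] [Algebra ℂ X] {E : X →ₗ[ℂ] X} {A : ι → Subalgebra ℂ X}

theorem IsFreeFamily.map_alternating (hA : IsFreeFamily E A) {c : ι} {x : X}
    (h : IsAlternating (fun c => (A c : Set X)) (fun x => E x = 0) c x) : E x = 0 := by
  obtain ⟨k, i, y, -, h1, h2, h3, rfl⟩ : ∃ (k : ℕ) (i : Fin (k + 1) → ι) (y : Fin (k + 1) → X),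
      i 0 = c ∧ (∀ j, y j ∈ A (i j)) ∧ (∀ j, E (y j) = 0) ∧
      (∀ j j' : Fin (k + 1), (j : ℕ) + 1 = j' → i j ≠ i j') ∧ (List.ofFn y).prod = x := by
    induction h with
    | @single c t h1 h2 =>
      refine ⟨0, fun _ => c, fun _ => t, rfl, fun _ => h1, fun _ => h2, fun j j' h => ?_, by simp⟩
      omega
    | @cons c c' t s h1 h2 h3 _ ih =>
      obtain ⟨k, i, y, h4, h5, h6, h7, h8⟩ := ih
      refine ⟨k + 1, Fin.cons c i, Fin.cons t y, rfl, ?_, ?_, ?_, ?_⟩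
      · exact fun j => Fin.cases h1 (fun j => by simpa using h5 j) j
      · exact fun j => Fin.cases h2 (fun j => by simpa using h6 j) j
      · intro j j'
        refine Fin.cases ?_ (fun j => ?_) j <;> refine Fin.cases ?_ (fun j' => ?_) j'
        · simp
        · intro h
          have : j' = 0 := by
            ext
            simpa using h.symm
          subst this
          simpa [h4] using h3
        · simp
        · intro h
          simpa using h7 j j' (by simpa using h)
      · rw [List.ofFn_succ, List.prod_cons]
        simp only [Fin.cons_zero, Fin.cons_succ, h8]
  exact hA (k + 1) (by omega) i y h1 h2 h3

/-- `x s` has expectation zero for an alternating product `s` of centred elements that starts with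
an index different from that of `x`. -/
theorem IsFreeFamily.map_mul_alternating (hE : IsCondExp E) (hD : ∀ c x, E x ∈ A c)
    (hA : IsFreeFamily E A) {c c' : ι} {x s : X} (hx : x ∈ A c) (hc : c ≠ c')
    (h : IsAlternating (fun c => (A c : Set X)) (fun x => E x = 0) c' s) : E (x * s) = 0 := by
  have h1 : x * s = (x - E x) * s + E x * s := by rw [← add_mul, sub_add_cancel]
  rw [h1, map_add, hE.map_left, hA.map_alternating h, mul_zero, add_zero]
  exact hA.map_alternating (.cons ((A c).sub_mem hx (hD c x)) (hE.map_sub_map x) hc h)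

end Freeness

/-! ### Reading operators -/

/-- Fixing the length through the dummy letter `y` lets cumulants of different lists be compared as
values of one multilinear map. -/
theorem listCumulant_update {X : Type*} [Ring X] (E : X → X) (u v : List X) (x y : X) :
    listCumulant E (u ++ x :: v) = nestedCumulant E (u ++ y :: v).length
      (Function.update (u ++ y :: v).get ⟨u.length, by simp⟩ x) := by
  have hl : (u ++ x :: v).length = (u ++ y :: v).length := by simp
  refine family_congr (nestedCumulant E) hl _ _ fun j => ?_
  rcases eq_or_ne (j : ℕ) u.length with hj | hj
  · have : Fin.cast hl j = ⟨u.length, by simp⟩ := Fin.ext hj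
    rw [this, Function.update_self]
    simp [hj]
  · rw [Function.update_of_ne fun h => hj (congrArg Fin.val h)]
    simp only [List.get_eq_getElem, Fin.val_cast]
    rcases lt_or_gt_of_ne hj with h | h
    · rw [List.getElem_append_left h, List.getElem_append_left h]
    · rw [List.getElem_append_right h.le, List.getElem_append_right h.le,
        List.getElem_cons, List.getElem_cons, dif_neg (by omega), dif_neg (by omega)]

section Operators

variable {X : Type*} [Ring X] [Algebra ℂ X]

/-- Functions of a block under construction. -/
abbrev BlockFun (X : Type*) : Type _ := List X → X → X → X

/-- Functions of a block that are linear in the completed arguments and in the current gap, and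
balanced over the range of `E` between the last letter and the gap. -/
structure IsBalanced (E : X →ₗ[ℂ] X) (Φ : BlockFun X) : Prop where
  add_gap : ∀ u b g h, Φ u b (g + h) = Φ u b g + Φ u b h
  smul_gap : ∀ u b (r : ℂ) g, Φ u b (r • g) = r • Φ u b g
  add_arg : ∀ u v x y b g, Φ (u ++ (x + y) :: v) b g = Φ (u ++ x :: v) b g + Φ (u ++ y :: v) b g
  smul_arg : ∀ u v (r : ℂ) x b g, Φ (u ++ (r • x) :: v) b g = r • Φ (u ++ x :: v) b g
  balance : ∀ u b x g, Φ u (b * E x) g = Φ u b (E x * g)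

variable {E : X →ₗ[ℂ] X}

theorem IsBalanced.zero_last {Φ : BlockFun X} (h : IsBalanced E Φ) (u : List X) (b g : X) :
    Φ (u ++ [0]) b g = 0 := by
  simpa using h.smul_arg u [] 0 0 b g

/-- When the letter joins, the old gap enters only through `b * E g`, which is linear in `g`;
balance follows from `E (E x * g) = E x * E g`. -/
theorem IsBalanced.readLetter (hE : IsCondExp E) {Φ : BlockFun X} (h : IsBalanced E Φ)
    (J : Bool) (a : X) : IsBalanced E (readLetter E J a Φ) where
  add_gap u b g k := by
    cases J <;>
      simp [FreeICA.readLetter, add_mul, mul_add, h.add_gap, h.add_arg, add_add_add_comm]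
  smul_gap u b r g := by
    cases J <;> simp [FreeICA.readLetter, h.smul_gap, h.smul_arg]
  add_arg u v x y b g := by
    cases J <;> simp [FreeICA.readLetter, h.add_arg, add_add_add_comm]
  smul_arg u v r x b g := by
    cases J <;> simp [FreeICA.readLetter, h.smul_arg]
  balance u b x g := by
    cases J <;> simp [FreeICA.readLetter, h.balance, hE.map_left, mul_assoc]

theorem IsBalanced.mul_gap {Φ : BlockFun X} (h : IsBalanced E Φ) (d : X) :
    IsBalanced E (fun u b g => Φ u b (g * d)) where
  add_gap u b g k := by simp [add_mul, h.add_gap]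
  smul_gap u b r g := by simp [h.smul_gap]
  add_arg u v x y b g := by simp [h.add_arg]
  smul_arg u v r x b g := by simp [h.smul_arg]
  balance u b x g := by simp [h.balance, mul_assoc]

theorem IsBalanced.add {Φ Ψ : BlockFun X} (h : IsBalanced E Φ) (h' : IsBalanced E Ψ) :
    IsBalanced E (Φ + Ψ) where
  add_gap u b g k := by simp [h.add_gap, h'.add_gap, add_add_add_comm]
  smul_gap u b r g := by simp [h.smul_gap, h'.smul_gap]
  add_arg u v x y b g := by simp [h.add_arg, h'.add_arg, add_add_add_comm]
  smul_arg u v r x b g := by simp [h.smul_arg, h'.smul_arg]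
  balance u b x g := by simp [h.balance, h'.balance]

theorem IsBalanced.smul {Φ : BlockFun X} (h : IsBalanced E Φ) (c : ℂ) :
    IsBalanced E (c • Φ) where
  add_gap u b g k := by simp [h.add_gap]
  smul_gap u b r g := by simp [h.smul_gap, smul_comm c r]
  add_arg u v x y b g := by simp [h.add_arg]
  smul_arg u v r x b g := by simp [h.smul_arg, smul_comm c r]
  balance u b x g := by simp [h.balance]

theorem listCumulant_add (E : X →ₗ[ℂ] X) (u v : List X) (x y : X) :
    listCumulant E (u ++ (x + y) :: v) =
      listCumulant E (u ++ x :: v) + listCumulant E (u ++ y :: v) := by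
  obtain ⟨M, hM⟩ := nestedCumulant_multilinear E (u ++ (0 : X) :: v).length
  simp only [listCumulant_update E u v _ 0, ← hM, M.map_update_add]

theorem listCumulant_smul (E : X →ₗ[ℂ] X) (u v : List X) (r : ℂ) (x : X) :
    listCumulant E (u ++ (r • x) :: v) = r • listCumulant E (u ++ x :: v) := by
  obtain ⟨M, hM⟩ := nestedCumulant_multilinear E (u ++ (0 : X) :: v).length
  simp only [listCumulant_update E u v _ 0, ← hM, M.map_update_smul]

theorem isBalanced_closeBlock (hE : IsCondExp E) : IsBalanced E (closeBlock E) where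
  add_gap u b g k := by simp [closeBlock, mul_add, listCumulant_add]
  smul_gap u b r g := by simp [closeBlock, listCumulant_smul]
  add_arg u v x y b g := by simp [closeBlock, listCumulant_add]
  smul_arg u v r x b g := by simp [closeBlock, listCumulant_smul]
  balance u b x g := by simp [closeBlock, hE.map_left, mul_assoc]

/-- The space of balanced functions. -/
def balancedFun (E : X →ₗ[ℂ] X) : Submodule ℂ (BlockFun X) where
  carrier := {Φ | IsBalanced E Φ}
  add_mem' h h' := IsBalanced.add h h'
  zero_mem' := ⟨by simp, by simp, by simp, by simp, by simp⟩
  smul_mem' c _ h := IsBalanced.smul h c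

/-- `readLetter` as an operator on balanced functions. -/
def letterOp (hE : IsCondExp E) (J : Bool) (a : X) : Module.End ℂ (balancedFun E) where
  toFun Φ := ⟨readLetter E J a Φ.1, IsBalanced.readLetter hE Φ.2 J a⟩
  map_add' Φ Ψ := by
    ext u b g
    cases J <;> simp [readLetter, add_add_add_comm]
  map_smul' r Φ := by
    ext u b g
    cases J <;> simp [readLetter]

/-- Multiplication of the current gap, as an operator on balanced functions. -/
def gapOp (E : X →ₗ[ℂ] X) : X →ₗ[ℂ] Module.End ℂ (balancedFun E) where
  toFun d :=
    { toFun := fun Φ => ⟨fun u b g => Φ.1 u b (g * d), IsBalanced.mul_gap Φ.2 d⟩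
      map_add' := fun _ _ => rfl
      map_smul' := fun _ _ => rfl }
  map_add' d d' := by
    ext Φ u b g
    simp [mul_add, Φ.2.add_gap]
  map_smul' r d := by
    ext Φ u b g
    simp [Φ.2.smul_gap]

theorem letterOp_apply (hE : IsCondExp E) (J : Bool) (a : X) (Φ : balancedFun E) (u : List X)
    (b g : X) : (letterOp hE J a Φ).1 u b g =
      Φ.1 u b (g * a) + if J then Φ.1 (u ++ [b * E g]) a 1 else 0 := rfl

theorem gapOp_apply (d : X) (Φ : balancedFun E) (u : List X) (b g : X) :
    (gapOp E d Φ).1 u b g = Φ.1 u b (g * d) := rfl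

/-- The value of a completed block, as a balanced function. -/
noncomputable def closingFun (hE : IsCondExp E) : balancedFun E :=
  ⟨closeBlock E, isBalanced_closeBlock hE⟩

end Operators

/-! ### Reduction to alternating products -/

section Reduction

variable {B ι : Type*} [Ring B] [Algebra ℂ B]

/-- If `ε` maps onto elements common to all subalgebras `T c`, every product of elements of these
subalgebras is a sum of a value of `ε` and alternating products of elements killed by `ε`. -/
theorem prod_mem_span_alternating {ε : B →ₗ[ℂ] B} (hε : IsCondExp ε)
    {T : ι → Subalgebra ℂ B} (hT : ∀ c t, ε t ∈ T c) (l : List B) (hl : ∀ t ∈ l, ∃ c, t ∈ T c) :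
    l.prod ∈ Submodule.span ℂ (Set.range ε ∪
      {s | ∃ c, IsAlternating (fun c => (T c : Set B)) (fun t => ε t = 0) c s}) := by
  set N := Submodule.span ℂ (Set.range ε ∪
      {s | ∃ c, IsAlternating (fun c => (T c : Set B)) (fun t => ε t = 0) c s}) with hN
  have hεN : ∀ t, ε t ∈ N := fun t => Submodule.subset_span (Or.inl ⟨t, rfl⟩)
  have haN : ∀ c s, IsAlternating (fun c => (T c : Set B)) (fun t => ε t = 0) c s → s ∈ N :=
    fun c s h => Submodule.subset_span (Or.inr ⟨c, h⟩)
  have hmul : ∀ x c s, IsAlternating (fun c => (T c : Set B)) (fun t => ε t = 0) c s →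
      IsAlternating (fun c => (T c : Set B)) (fun t => ε t = 0) c (ε x * s) := by
    intro x c s h
    cases h with
    | single h1 h2 =>
      exact .single ((T c).mul_mem (hT c x) h1) (by rw [hε.map_left, h2, mul_zero])
    | cons h1 h2 h3 h4 =>
      rw [← mul_assoc]
      exact .cons ((T c).mul_mem (hT c x) h1) (by rw [hε.map_left, h2, mul_zero]) h3 h4
  have hsingle : ∀ c, ∀ t ∈ T c, t ∈ N := by
    intro c t ht
    rw [← sub_add_cancel t (ε t)]
    exact N.add_mem (haN c _ (.single ((T c).sub_mem ht (hT c t)) (hε.map_sub_map t))) (hεN t)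
  have hcons : ∀ c c' t s, t ∈ T c → c ≠ c' →
      IsAlternating (fun c => (T c : Set B)) (fun t => ε t = 0) c' s → t * s ∈ N := by
    intro c c' t s ht hc hs
    rw [← sub_add_cancel t (ε t), add_mul]
    exact N.add_mem (haN c _ (.cons ((T c).sub_mem ht (hT c t)) (hε.map_sub_map t) hc hs))
      (haN c' _ (hmul _ _ _ hs))
  -- The span is stable under left multiplication by each `T c`: a factor from the subalgebra of the
  -- leading factor is merged with it, and the result is then centred again.
  have hstep : ∀ c, ∀ t ∈ T c, ∀ n ∈ N, t * n ∈ N := by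
    intro c t ht n hn
    induction hn using Submodule.span_induction with
    | zero => rw [mul_zero]; exact N.zero_mem
    | add x y _ _ hx hy => rw [mul_add]; exact N.add_mem hx hy
    | smul r x _ hx => rw [mul_smul_comm]; exact N.smul_mem r hx
    | mem x hx =>
      rcases hx with ⟨y, rfl⟩ | ⟨c', hx⟩
      · exact hsingle c _ ((T c).mul_mem ht (hT c y))
      · by_cases hc : c = c'
        · subst hc
          cases hx with
          | single h1 h2 => exact hsingle c _ ((T c).mul_mem ht h1)
          | cons h1 h2 h3 h4 =>
            rw [← mul_assoc]
            exact hcons c _ _ _ ((T c).mul_mem ht h1) h3 h4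
        · exact hcons c c' t x ht hc hx
  induction l with
  | nil =>
    rw [List.prod_nil, ← hε.map_one]
    exact hεN 1
  | cons t l ih =>
    obtain ⟨c, hc⟩ := hl t (by simp)
    rw [List.prod_cons]
    exact hstep c t hc _ (ih fun s hs => hl s (by simp [hs]))

end Reduction

/-! ### Moments of free elements -/

section Moments

variable {X ι : Type*} [Ring X] [Algebra ℂ X] {E : X →ₗ[ℂ] X}

/-- The lift of the conditional expectation to pairs of elements and operators. -/
def liftExp (E : X →ₗ[ℂ] X) :
    X × Module.End ℂ (balancedFun E) →ₗ[ℂ] X × Module.End ℂ (balancedFun E) :=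
  (E.prod (gapOp E ∘ₗ E)) ∘ₗ LinearMap.fst ℂ _ _

theorem liftExp_apply (t : X × Module.End ℂ (balancedFun E)) :
    liftExp E t = (E t.1, gapOp E (E t.1)) := rfl

theorem gapOp_mul (d d' : X) : gapOp E (d * d') = gapOp E d * gapOp E d' := by
  ext Φ u b g
  simp [gapOp_apply, mul_assoc]

theorem gapOp_one : gapOp E 1 = 1 := by
  ext Φ u b g
  simp [gapOp_apply]

/-- The lift makes `prod_mem_span_alternating` applicable to pairs: centring a pair centres its
first component and changes its operator by a mere gap multiplication. -/
theorem isCondExp_liftExp (hE : IsCondExp E) : IsCondExp (X := X × Module.End ℂ (balancedFun E)) (liftExp E) where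
  map_one := by simp [liftExp_apply, hE.map_one, gapOp_one]
  map_left a b := by simp [liftExp_apply, hE.map_left, gapOp_mul]
  map_right a b := by simp [liftExp_apply, hE.map_right, gapOp_mul]

theorem liftExp_eq_zero {t : X × Module.End ℂ (balancedFun E)} :
    liftExp E t = 0 ↔ E t.1 = 0 := by
  simp only [liftExp_apply, Prod.mk_eq_zero]
  exact ⟨And.left, fun h => ⟨h, by rw [h, map_zero]⟩⟩

/-- The algebra generated by the letters from `A` and the range of `E`, acting on the functions of
a block which letters from `A` join if `J` holds. -/
def pairAlgebra (hE : IsCondExp E) (J : Bool) (A : Subalgebra ℂ X) :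
    Subalgebra ℂ (X × Module.End ℂ (balancedFun E)) :=
  Algebra.adjoin ℂ ((fun a => (a, letterOp hE J a)) '' A ∪ Set.range (liftExp E))

theorem fst_mem_of_mem_pairAlgebra {hE : IsCondExp E} {J : Bool} {A : Subalgebra ℂ X}
    (hD : ∀ x, E x ∈ A) {t : X × Module.End ℂ (balancedFun E)} (ht : t ∈ pairAlgebra hE J A) :
    t.1 ∈ A := by
  induction ht using Algebra.adjoin_induction with
  | mem t h =>
    rcases h with ⟨a, ha, rfl⟩ | ⟨s, rfl⟩
    · exact ha
    · exact hD _
  | algebraMap r => exact A.algebraMap_mem r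
  | add x y _ _ hx hy => exact A.add_mem hx hy
  | mul x y _ _ hx hy => exact A.mul_mem hx hy

/-- If no letter can join the block, an element of `pairAlgebra` multiplies the gap. -/
theorem snd_apply_eq_mul {hE : IsCondExp E} {J : Bool} {A : Subalgebra ℂ X}
    (hD : ∀ x, E x ∈ A) {t : X × Module.End ℂ (balancedFun E)} (ht : t ∈ pairAlgebra hE J A)
    {g : X} (hg : J = true → ∀ x ∈ A, E (g * x) = 0) (Φ : balancedFun E) (u : List X) (b : X) :
    (t.2 Φ).1 u b g = Φ.1 u b (g * t.1) := by
  induction ht using Algebra.adjoin_induction generalizing g Φ with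
  | mem t h =>
    rcases h with ⟨a, ha, rfl⟩ | ⟨s, rfl⟩
    · dsimp only
      rw [letterOp_apply]
      split_ifs with hJ
      · have := hg hJ 1 A.one_mem
        rw [mul_one] at this
        rw [this, mul_zero, Φ.2.zero_last, add_zero]
      · rw [add_zero]
    · rfl
  | algebraMap r =>
    have : (algebraMap ℂ (X × Module.End ℂ (balancedFun E)) r).2 Φ = r • Φ := rfl
    rw [this, Prod.algebraMap_apply, ← Algebra.commutes, ← Algebra.smul_def, Φ.2.smul_gap]
    rfl
  | add x y _ _ hx hy =>
    rw [Prod.fst_add, mul_add, Φ.2.add_gap, ← hx hg, ← hy hg]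
    rfl
  | mul x y hxA _ hx hy =>
    rw [Prod.fst_mul, ← mul_assoc, ← hy, ← hx hg]
    · rfl
    · intro hJ z hz
      rw [mul_assoc]
      exact hg hJ _ (A.mul_mem (fst_mem_of_mem_pairAlgebra hD hxA) hz)

/-- Functions vanishing on gaps from `A` are preserved by `pairAlgebra`. -/
theorem snd_apply_eq_zero {hE : IsCondExp E} {J : Bool} {A : Subalgebra ℂ X}
    (hD : ∀ x, E x ∈ A) {t : X × Module.End ℂ (balancedFun E)} (ht : t ∈ pairAlgebra hE J A)
    {Φ : balancedFun E} (hΦ : ∀ u b, ∀ g ∈ A, Φ.1 u b g = 0) (u : List X) (b : X) {g : X}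
    (hg : g ∈ A) : (t.2 Φ).1 u b g = 0 := by
  induction ht using Algebra.adjoin_induction generalizing g Φ u b with
  | mem t h =>
    rcases h with ⟨a, ha, rfl⟩ | ⟨s, rfl⟩
    · dsimp only
      rw [letterOp_apply, hΦ _ _ _ (A.mul_mem hg ha), hΦ _ _ _ A.one_mem, ite_self, add_zero]
    · exact hΦ _ _ _ (A.mul_mem hg (hD _))
  | algebraMap r =>
    have : (algebraMap ℂ (X × Module.End ℂ (balancedFun E)) r).2 Φ = r • Φ := rfl
    rw [this]
    exact (congrArg (r • ·) (hΦ u b g hg)).trans (smul_zero r)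
  | add x y _ _ hx hy =>
    have h1 := hx hΦ u b hg
    have h2 := hy hΦ u b hg
    exact (congrArg₂ (· + ·) h1 h2).trans (add_zero 0)
  | mul x y _ _ hx hy =>
    exact hx (fun u b g hg => hy hΦ u b hg) u b hg

/-- The words over letters that join the block act like the elements of `pairAlgebra`. -/
theorem exists_word_of_mem_closure {hE : IsCondExp E} {A : Subalgebra ℂ X}
    {t : X × Module.End ℂ (balancedFun E)}
    (ht : t ∈ Submonoid.closure
      ((fun a => (a, letterOp hE true a)) '' (A : Set X) ∪ Set.range (liftExp E))) :
    ∃ (d : X) (w : List X), t.1 = E d * w.prod ∧ ∀ (Φ : balancedFun E) u b g,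
      (t.2 Φ).1 u b g = ((w.map (letterOp hE true)).prod Φ).1 u b (g * E d) := by
  induction ht using Submonoid.closure_induction_left with
  | one => exact ⟨1, [], by simp [hE.map_one], fun Φ u b g => by simp [hE.map_one]⟩
  | mul_left x hx y _ ih =>
    obtain ⟨d, w, h1, h2⟩ := ih
    rcases hx with ⟨a, -, rfl⟩ | ⟨s, rfl⟩
    · refine ⟨1, (a * E d) :: w, by simp [hE.map_one, h1, mul_assoc], fun Φ u b g => ?_⟩
      rw [List.map_cons, List.prod_cons, hE.map_one, mul_one]
      change (letterOp hE true a (y.2 Φ)).1 u b g = (letterOp hE true (a * E d) _).1 u b g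
      have := ((w.map (letterOp hE true)).prod Φ).2.balance (u ++ [b * E g]) a d 1
      rw [letterOp_apply, letterOp_apply, h2, h2, if_pos rfl, if_pos rfl, one_mul, mul_assoc,
        this, mul_one]
    · refine ⟨E s.1 * d, w, ?_, fun Φ u b g => ?_⟩
      · rw [hE.map_left, Prod.fst_mul, h1, mul_assoc]
        rfl
      · rw [hE.map_left, ← mul_assoc, ← h2]
        rfl

theorem foldr_readLetter_eq_prod (hE : IsCondExp E) (w : List (Bool × X)) (Φ : balancedFun E) :
    w.foldr (fun p => readLetter E p.1 p.2) Φ.1 =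
      ((w.map fun p => letterOp hE p.1 p.2).prod Φ).1 := by
  induction w with
  | nil => rfl
  | cons p w ih =>
    rw [List.foldr_cons, ih]
    rfl

/-- The moment-cumulant formula on the algebra of a single index. -/
theorem map_mul_eq_of_mem_pairAlgebra {hE : IsCondExp E} {A : Subalgebra ℂ X}
    {t : X × Module.End ℂ (balancedFun E)} (ht : t ∈ pairAlgebra hE true A) (a : X) :
    E (a * t.1) = (t.2 (closingFun hE)).1 [] a 1 := by
  rw [pairAlgebra, ← Subalgebra.mem_toSubmodule, Algebra.adjoin_eq_span] at ht
  induction ht using Submodule.span_induction with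
  | zero => simp
  | add x y _ _ hx hy =>
    rw [Prod.fst_add, mul_add, map_add, hx, hy]
    rfl
  | smul r x _ hx =>
    rw [Prod.smul_fst, mul_smul_comm, map_smul, hx]
    rfl
  | mem t ht =>
    obtain ⟨d, w, h1, h2⟩ := exists_word_of_mem_closure ht
    rw [h1, h2, one_mul, ← mul_assoc, moment_eq_foldr E hE.map_one]
    have := foldr_readLetter_eq_prod hE (w.map fun a => (true, a)) (closingFun hE)
    rw [List.foldr_map, List.map_map] at this
    have h3 : (fun p : Bool × X => letterOp hE p.1 p.2) ∘ (fun a => (true, a))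
        = letterOp hE true := rfl
    rw [h3] at this
    have h4 := (((w.map (letterOp hE true)).prod (closingFun hE)).2).balance [] a d 1
    rw [mul_one] at h4
    rw [← h4, ← this]
    rfl

/-! ### Blocks of a single index, and the action of alternating products. -/

variable [DecidableEq ι] {A : ι → Subalgebra ℂ X}

/-- The operators for blocks of the letters with index `i`. -/
def colourAlgebra (hE : IsCondExp E) (A : ι → Subalgebra ℂ X) (i c : ι) :
    Subalgebra ℂ (X × Module.End ℂ (balancedFun E)) :=
  pairAlgebra hE (decide (c = i)) (A c)

theorem IsAlternating.fst {hE : IsCondExp E} (hD : ∀ c x, E x ∈ A c) {i c : ι}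
    {s : X × Module.End ℂ (balancedFun E)}
    (h : IsAlternating (fun c => (colourAlgebra hE A i c : Set (X × _)))
      (fun t => liftExp E t = 0) c s) :
    IsAlternating (fun c => (A c : Set X)) (fun x => E x = 0) c s.1 :=
  h.map (MulHom.fst _ _) (fun c _ ht => fst_mem_of_mem_pairAlgebra (hD c) ht)
    fun _ ht => liftExp_eq_zero.1 ht

theorem closingFun_eq_zero (hE : IsCondExp E) {g : X} (hg : E g = 0) (u : List X) (b : X) :
    (closingFun hE).1 u b g = 0 := by
  change listCumulant E (u ++ [b * E g]) = 0
  rw [hg, mul_zero]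
  simpa using listCumulant_smul E u [] 0 0

/-- The action of an alternating product vanishes on gaps annihilated by alternating products. -/
theorem alternating_apply_eq_zero {hE : IsCondExp E} (hD : ∀ c x, E x ∈ A c) {i c c' : ι}
    (hc : c' ≠ c) {s : X × Module.End ℂ (balancedFun E)}
    (h : IsAlternating (fun c => (colourAlgebra hE A i c : Set (X × _)))
      (fun t => liftExp E t = 0) c s) {g : X} (hg : E g = 0)
    (hg' : ∀ c, c' ≠ c → ∀ x,
      IsAlternating (fun c => (A c : Set X)) (fun x => E x = 0) c x → E (g * x) = 0)
    (u : List X) (b : X) : (s.2 (closingFun hE)).1 u b g = 0 := by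
  have hmul : ∀ {c c' g}, c' ≠ c → E g = 0 → (∀ c, c' ≠ c → ∀ x,
      IsAlternating (fun c => (A c : Set X)) (fun x => E x = 0) c x → E (g * x) = 0) →
      ∀ x ∈ A c, E (g * x) = 0 := by
    intro c c' g hc hg hg' x hx
    rw [← sub_add_cancel x (E x), mul_add, map_add, hE.map_right, hg, zero_mul, add_zero]
    exact hg' c hc _ (.single ((A c).sub_mem hx (hD c x)) (hE.map_sub_map x))
  induction h generalizing g c' with
  | @single c t h1 h2 =>
    have h3 := hmul hc hg hg'
    rw [snd_apply_eq_mul (hD c) h1 (fun _ => h3)]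
    exact closingFun_eq_zero hE (h3 _ (fst_mem_of_mem_pairAlgebra (hD c) h1)) u b
  | @cons c c'' t s h1 h2 h3 h4 ih =>
    have h5 := hmul hc hg hg'
    have h6 := fst_mem_of_mem_pairAlgebra (hD c) h1
    change (t.2 (s.2 (closingFun hE))).1 u b g = 0
    rw [snd_apply_eq_mul (hD c) h1 (fun _ => h5)]
    -- The factor `t` has only enlarged the gap to `g * t.1`. The new gap satisfies the same
    -- hypotheses, with `c` as the index that the next factor must avoid.
    refine ih h3 (h5 _ h6) fun c3 hc3 x hx => ?_
    rw [mul_assoc]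
    exact hg' c hc _ (.cons h6 (liftExp_eq_zero.1 h2) hc3 hx)

/-- The action of an alternating product that does not start with a letter of the block vanishes
on gaps consisting of letters of the block. -/
theorem alternating_apply_eq_zero_of_mem {hE : IsCondExp E} (hD : ∀ c x, E x ∈ A c)
    (hA : IsFreeFamily E A) {i c : ι} (hc : i ≠ c) {s : X × Module.End ℂ (balancedFun E)}
    (h : IsAlternating (fun c => (colourAlgebra hE A i c : Set (X × _)))
      (fun t => liftExp E t = 0) c s) {g : X} (hg : g ∈ A i) (u : List X) (b : X) :
    (s.2 (closingFun hE)).1 u b g = 0 := by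
  have hJ : ∀ {P : Prop}, decide (c = i) = true → P := fun h =>
    absurd (of_decide_eq_true h).symm hc
  cases h with
  | single h1 h2 =>
    rw [snd_apply_eq_mul (hD c) h1 hJ]
    exact closingFun_eq_zero hE (hA.map_mul_alternating hE hD hg hc
      (.single (fst_mem_of_mem_pairAlgebra (hD c) h1) (liftExp_eq_zero.1 h2))) u b
  | @cons _ c' t s h1 h2 h3 h4 =>
    have h6 := fst_mem_of_mem_pairAlgebra (hD c) h1
    change (t.2 (s.2 (closingFun hE))).1 u b g = 0
    rw [snd_apply_eq_mul (hD c) h1 hJ]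
    refine alternating_apply_eq_zero hD h3 h4 ?_ ?_ u b
    · exact hA.map_mul_alternating hE hD hg hc (.single h6 (liftExp_eq_zero.1 h2))
    · intro c3 hc3 x hx
      rw [mul_assoc]
      exact hA.map_mul_alternating hE hD hg hc (.cons h6 (liftExp_eq_zero.1 h2) hc3 hx)

/-- Both sides vanish unless `s` is a single factor of index `i`, in which case the unrestricted
formula for one subalgebra applies. If `s` starts with index `i` and continues, its tail acts as
zero on gaps from `A i`, and the first factor preserves this vanishing. -/
theorem map_mul_eq_of_alternating {hE : IsCondExp E} (hD : ∀ c x, E x ∈ A c)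
    (hA : IsFreeFamily E A) {i c : ι} {s : X × Module.End ℂ (balancedFun E)}
    (h : IsAlternating (fun c => (colourAlgebra hE A i c : Set (X × _)))
      (fun t => liftExp E t = 0) c s) {a : X} (ha : a ∈ A i) :
    E (a * s.1) = (s.2 (closingFun hE)).1 [] a 1 := by
  by_cases hc : i = c
  · subst hc
    cases h with
    | single h1 h2 =>
      refine map_mul_eq_of_mem_pairAlgebra (A := A i) ?_ a
      simpa [colourAlgebra] using h1
    | @cons _ c' t s h1 h2 h3 h4 =>
      rw [Prod.fst_mul, ← mul_assoc, hA.map_mul_alternating hE hD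
        ((A i).mul_mem ha (fst_mem_of_mem_pairAlgebra (hD i) h1)) h3 (h4.fst hD)]
      exact (snd_apply_eq_zero (hD i) h1 (fun u b g hg =>
        alternating_apply_eq_zero_of_mem hD hA h3 h4 hg u b) [] a (A i).one_mem).symm
  · rw [hA.map_mul_alternating hE hD ha hc (h.fst hD),
      alternating_apply_eq_zero_of_mem hD hA hc h (A i).one_mem]

/-- Moments of free elements are sums over the possible blocks of the first letter, all of whose
letters have the same index. -/
theorem moment_eq_foldr_of_isFreeFamily (hE : IsCondExp E) (hD : ∀ c x, E x ∈ A c)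
    (hA : IsFreeFamily E A) {i : ι} {a : X} (ha : a ∈ A i) (w : List (ι × X))
    (hw : ∀ p ∈ w, p.2 ∈ A p.1) :
    E (a * (w.map Prod.snd).prod) =
      w.foldr (fun p => readLetter E (decide (p.1 = i)) p.2) (closeBlock E) [] a 1 := by
  have hkey : ∀ t ∈ Submodule.span ℂ (Set.range (liftExp E) ∪
      {s | ∃ c, IsAlternating (fun c => (colourAlgebra hE A i c : Set (X × _)))
        (fun t => liftExp E t = 0) c s}),
      E (a * t.1) = (t.2 (closingFun hE)).1 [] a 1 := by
    intro t ht
    induction ht using Submodule.span_induction with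
    | zero => simp
    | add x y _ _ hx hy =>
      rw [Prod.fst_add, mul_add, map_add, hx, hy]
      rfl
    | smul r x _ hx =>
      rw [Prod.smul_fst, mul_smul_comm, map_smul, hx]
      rfl
    | mem t ht =>
      rcases ht with ⟨s, rfl⟩ | ⟨c, h⟩
      · refine map_mul_eq_of_mem_pairAlgebra (A := A i) ?_ a
        exact Algebra.subset_adjoin (Or.inr ⟨s, rfl⟩)
      · exact map_mul_eq_of_alternating hD hA h ha
  -- The word is multiplied out in the algebra of pairs, so that one reduction handles the moment
  -- and the reading operators together.
  have hmem := prod_mem_span_alternating (isCondExp_liftExp hE) (T := colourAlgebra hE A i)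
    (fun c t => Algebra.subset_adjoin (Or.inr ⟨t, rfl⟩))
    (w.map fun p => (p.2, letterOp hE (decide (p.1 = i)) p.2)) (by
      intro t ht
      obtain ⟨p, hp, rfl⟩ := List.mem_map.1 ht
      exact ⟨p.1, Algebra.subset_adjoin (Or.inl ⟨p.2, hw p hp, rfl⟩)⟩)
  have h1 := hkey _ hmem
  have h2 : ∀ w : List (ι × X),
      (w.map fun p => (p.2, letterOp hE (decide (p.1 = i)) p.2)).prod =
      ((w.map Prod.snd).prod, (w.map fun p => letterOp hE (decide (p.1 = i)) p.2).prod) := by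
    intro w
    induction w with
    | nil => rfl
    | cons p w ih =>
      rw [List.map_cons, List.prod_cons, ih]
      rfl
  rw [h2] at h1
  have h3 := foldr_readLetter_eq_prod hE (w.map fun p => (decide (p.1 = i), p.2)) (closingFun hE)
  rw [List.foldr_map, List.map_map] at h3
  refine h1.trans ?_
  have h4 : (closingFun hE).1 = closeBlock E := rfl
  rw [← h4, h3]
  rfl

end Moments

/-! ### Mixed cumulants of free elements -/

section Mixed

variable {X ι : Type*} [Ring X] [Algebra ℂ X] {E : X →ₗ[ℂ] X} {A : ι → Subalgebra ℂ X}

/-- The letters of the word `l` are not all from the same `A i`. -/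
def IsMixed (A : ι → Subalgebra ℂ X) (l : List (ι × X)) : Prop :=
  (∀ p ∈ l, p.2 ∈ A p.1) ∧ ∃ p ∈ l, ∃ q ∈ l, p.1 ≠ q.1

theorem IsMixed.append {l l' : List (ι × X)} (h : IsMixed A l) (h' : ∀ p ∈ l', p.2 ∈ A p.1) :
    IsMixed A (l ++ l') := by
  obtain ⟨h1, p, hp, q, hq, h2⟩ := h
  refine ⟨fun r hr => (List.mem_append.1 hr).elim (h1 r) (h' r), p, ?_, q, ?_, h2⟩ <;> simp [*]

theorem IsMixed.mul_map (hD : ∀ c x, E x ∈ A c) {l : List (ι × X)} {b : ι × X}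
    (h : IsMixed A (l ++ [b])) (g : X) : IsMixed A (l ++ [(b.1, b.2 * E g)]) := by
  obtain ⟨h1, p, hp, q, hq, h2⟩ := h
  refine ⟨fun r hr => ?_, ?_⟩
  · rcases List.mem_append.1 hr with h | h
    · exact h1 r (List.mem_append_left _ h)
    · rw [List.mem_singleton.1 h]
      exact (A _).mul_mem (h1 b (by simp)) (hD _ _)
  · simp only [List.mem_append, List.mem_singleton] at hp hq ⊢
    rcases hp with hp | rfl <;> rcases hq with hq | rfl
    · exact ⟨p, Or.inl hp, q, Or.inl hq, h2⟩
    · exact ⟨p, Or.inl hp, _, Or.inr rfl, h2⟩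
    · exact ⟨_, Or.inr rfl, q, Or.inl hq, h2⟩
    · exact absurd rfl h2

/-- Once a block is mixed it stays mixed, whatever joins it later; by the length bound every
resulting cumulant has order below `n`. -/
theorem foldr_eq_zero_of_mixed (hD : ∀ c x, E x ∈ A c) {n : ℕ}
    (hn : ∀ l, l.length < n → IsMixed A l → listCumulant E (l.map Prod.snd) = 0)
    (w l : List (ι × X)) (b : ι × X) (g : X) (hl : IsMixed A (l ++ [b]))
    (hw : ∀ p ∈ w, p.2 ∈ A p.1) (hlen : l.length + 1 + w.length < n) :
    (w.map Prod.snd).foldr (readLetter E true) (closeBlock E) (l.map Prod.snd) b.2 g = 0 := by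
  induction w generalizing l b g with
  | nil => simpa [closeBlock] using hn _ (by simpa using hlen) (hl.mul_map hD g)
  | cons a w ih =>
    have hw' : ∀ p ∈ w, p.2 ∈ A p.1 := fun p hp => hw p (by simp [hp])
    have ha : ∀ p ∈ [a], p.2 ∈ A p.1 := fun p hp => hw p (by simp_all)
    simp only [List.length_cons] at hlen
    rw [List.map_cons, List.foldr_cons, readLetter, if_pos rfl,
      ih l b _ hl hw' (by omega), zero_add]
    have := ih (l ++ [(b.1, b.2 * E g)]) a 1 ((hl.mul_map hD g).append ha) hw'
      (by simp only [List.length_append, List.length_cons, List.length_nil]; omega)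
    simpa using this

/-- A letter left out of the block lowers the order below `n`, so only the term in which every
letter joins survives. Its gaps are all empty. -/
theorem foldr_eq_listCumulant_of_mixed (hE : IsCondExp E) (hD : ∀ c x, E x ∈ A c) {n : ℕ}
    (hn : ∀ l, l.length < n → IsMixed A l → listCumulant E (l.map Prod.snd) = 0)
    (w l : List (ι × X)) (b : ι × X) (hl : IsMixed A (l ++ [b]))
    (hw : ∀ p ∈ w, p.2 ∈ A p.1) (hlen : l.length + 1 + w.length = n) :
    (w.map Prod.snd).foldr (readLetter E true) (closeBlock E) (l.map Prod.snd) b.2 1 =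
      listCumulant E (l.map Prod.snd ++ b.2 :: w.map Prod.snd) := by
  induction w generalizing l b with
  | nil => simp [closeBlock, hE.map_one]
  | cons a w ih =>
    have hw' : ∀ p ∈ w, p.2 ∈ A p.1 := fun p hp => hw p (by simp [hp])
    have ha : ∀ p ∈ [a], p.2 ∈ A p.1 := fun p hp => hw p (by simp_all)
    simp only [List.length_cons] at hlen
    rw [List.map_cons, List.foldr_cons, readLetter, if_pos rfl,
      foldr_eq_zero_of_mixed hD hn w l b _ hl hw' (by omega), zero_add, hE.map_one, mul_one]
    have := ih (l ++ [b]) a (hl.append ha) hw'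
      (by simp only [List.length_append, List.length_cons, List.length_nil]; omega)
    simpa using this

variable [DecidableEq ι]

/-- The unrestricted sum has extra terms only where a letter of index other than `i` joins; these
are mixed cumulants of order below `n`. -/
theorem foldr_eq_foldr_of_short (hD : ∀ c x, E x ∈ A c) {n : ℕ}
    (hn : ∀ l, l.length < n → IsMixed A l → listCumulant E (l.map Prod.snd) = 0)
    (w : List (ι × X)) (i : ι) (u : List X) (b g : X) (hu : ∀ x ∈ u, x ∈ A i) (hb : b ∈ A i)
    (hw : ∀ p ∈ w, p.2 ∈ A p.1) (hlen : u.length + 1 + w.length < n) :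
    (w.map Prod.snd).foldr (readLetter E true) (closeBlock E) u b g =
      w.foldr (fun p => readLetter E (decide (p.1 = i)) p.2) (closeBlock E) u b g := by
  induction w generalizing u b g with
  | nil => rfl
  | cons a w ih =>
    have hw' : ∀ p ∈ w, p.2 ∈ A p.1 := fun p hp => hw p (by simp [hp])
    have ha := hw a (by simp)
    have hu' : ∀ x ∈ u ++ [b * E g], x ∈ A i := by
      intro x hx
      rcases List.mem_append.1 hx with h | h
      · exact hu x h
      · rw [List.mem_singleton.1 h]
        exact (A i).mul_mem hb (hD i g)
    simp only [List.length_cons] at hlen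
    rw [List.map_cons, List.foldr_cons, List.foldr_cons, readLetter, readLetter, if_pos rfl,
      ih u b _ hu hb hw' (by omega)]
    congr 1
    by_cases hi : a.1 = i
    · rw [if_pos (decide_eq_true hi)]
      exact ih _ _ _ hu' (hi ▸ ha) hw' (by simp; omega)
    · rw [if_neg (by simpa using hi)]
      have := foldr_eq_zero_of_mixed hD hn w ((u ++ [b * E g]).map fun x => (i, x)) a 1
        ⟨fun p hp => ?_, (i, b * E g), by simp, a, by simp, fun h => hi h.symm⟩ hw'
        (by simp; omega)
      · simpa [Function.comp_def] using this
      · rcases List.mem_append.1 hp with h | h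
        · obtain ⟨x, hx, rfl⟩ := List.mem_map.1 h
          exact hu' x hx
        · rw [List.mem_singleton.1 h]
          exact ha

/-- At total length exactly `n`, the one extra term not covered by the induction hypothesis is the
block containing all letters. The restricted sum omits it because of `hmix`. -/
theorem foldr_eq_foldr_add_listCumulant (hE : IsCondExp E) (hD : ∀ c x, E x ∈ A c) {n : ℕ}
    (hn : ∀ l, l.length < n → IsMixed A l → listCumulant E (l.map Prod.snd) = 0)
    (w : List (ι × X)) (i : ι) (u : List X) (b : X) (hu : ∀ x ∈ u, x ∈ A i) (hb : b ∈ A i)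
    (hw : ∀ p ∈ w, p.2 ∈ A p.1) (hlen : u.length + 1 + w.length = n)
    (hmix : ∃ p ∈ w, p.1 ≠ i) :
    (w.map Prod.snd).foldr (readLetter E true) (closeBlock E) u b 1 =
      w.foldr (fun p => readLetter E (decide (p.1 = i)) p.2) (closeBlock E) u b 1 +
        listCumulant E (u ++ b :: w.map Prod.snd) := by
  induction w generalizing u b with
  | nil => simp at hmix
  | cons a w ih =>
    have hw' : ∀ p ∈ w, p.2 ∈ A p.1 := fun p hp => hw p (by simp [hp])
    have ha := hw a (by simp)
    have hu' : ∀ x ∈ u ++ [b], x ∈ A i := by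
      intro x hx
      rcases List.mem_append.1 hx with h | h
      · exact hu x h
      · rwa [List.mem_singleton.1 h]
    simp only [List.length_cons] at hlen
    rw [List.map_cons, List.foldr_cons, List.foldr_cons, readLetter, readLetter, if_pos rfl,
      foldr_eq_foldr_of_short hD hn w i u b _ hu hb hw' (by omega), hE.map_one, mul_one,
      add_assoc]
    congr 1
    by_cases hi : a.1 = i
    · rw [if_pos (decide_eq_true hi), ih _ _ hu' (hi ▸ ha) hw' (by simp; omega)]
      · simp
      · obtain ⟨p, hp, hpi⟩ := hmix
        rcases List.mem_cons.1 hp with rfl | hp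
        · exact absurd hi hpi
        · exact ⟨p, hp, hpi⟩
    · rw [if_neg (by simpa using hi), zero_add]
      have := foldr_eq_listCumulant_of_mixed hE hD hn w ((u ++ [b]).map fun x => (i, x)) a
        ⟨fun p hp => ?_, (i, b), by simp, a, by simp, fun h => hi h.symm⟩ hw'
        (by simp; omega)
      · simpa [Function.comp_def] using this
      · rcases List.mem_append.1 hp with h | h
        · obtain ⟨x, hx, rfl⟩ := List.mem_map.1 h
          exact hu' x hx
        · rw [List.mem_singleton.1 h]
          exact ha

/-- Mixed cumulants of free elements vanish. -/
theorem listCumulant_eq_zero_of_mixed (hE : IsCondExp E) (hD : ∀ c x, E x ∈ A c)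
    (hA : IsFreeFamily E A) (l : List (ι × X)) (hl : IsMixed A l) :
    listCumulant E (l.map Prod.snd) = 0 := by
  induction hn : l.length using Nat.strong_induction_on generalizing l with
  | _ n ih =>
    obtain ⟨h1, p, hp, q, hq, hpq⟩ := hl
    cases l with
    | nil => simp at hp
    | cons a w =>
      have hw : ∀ p ∈ w, p.2 ∈ A p.1 := fun p hp => h1 p (by simp [hp])
      have hmix : ∃ p ∈ w, p.1 ≠ a.1 := by
        by_contra! hc
        have : ∀ r ∈ a :: w, r.1 = a.1 := fun r hr =>
          (List.mem_cons.1 hr).elim (fun h => h ▸ rfl) (hc r)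
        exact hpq ((this p hp).trans (this q hq).symm)
      have h2 := moment_eq_foldr_of_isFreeFamily hE hD hA (h1 a (by simp)) w hw
      -- The same moment is expanded with and without the restriction on blocks; the difference is
      -- the cumulant in question.
      rw [moment_eq_foldr E hE.map_one, foldr_eq_foldr_add_listCumulant hE hD
        (fun l hl hm => ih l.length hl l hm rfl) w a.1 [] a.2 (by simp) (h1 a (by simp)) hw
        (by simpa [add_comm] using hn) hmix] at h2
      simpa using h2

theorem nestedCumulant_eq_zero_of_mixed (hE : IsCondExp E) (hD : ∀ c x, E x ∈ A c)
    (hA : IsFreeFamily E A) {n : ℕ} (c : Fin n → ι) (a : Fin n → X) (ha : ∀ k, a k ∈ A (c k))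
    (hc : ∃ k k', c k ≠ c k') : nestedCumulant E n a = 0 := by
  have := listCumulant_eq_zero_of_mixed hE hD hA (List.ofFn fun k => (c k, a k)) ⟨?_, ?_⟩
  · rw [nestedCumulant_eq_listCumulant, ← this, List.map_ofFn]
    rfl
  · intro p hp
    obtain ⟨k, rfl⟩ := (List.mem_ofFn' _ _).1 hp
    exact ha k
  · obtain ⟨k, k', h⟩ := hc
    exact ⟨_, (List.mem_ofFn' _ _).2 ⟨k, rfl⟩, _, (List.mem_ofFn' _ _).2 ⟨k', rfl⟩, h⟩

end Mixed

/-! ### Scalar cumulants -/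

/-- For a scalar valued family the nested evaluation along a non-crossing partition is the product
over the blocks. -/
theorem nestedEval_eq_prod {X : Type*} [Ring X] [Algebra ℂ X] {f : (k : ℕ) → (Fin k → X) → X}
    (hf : IsMultilinearFamily f) {κ : (k : ℕ) → (Fin k → X) → ℂ}
    (hκ : ∀ k b, f k b = κ k b • 1) {n : ℕ}
    {π : Finpartition (Finset.univ : Finset (Fin n))} (hπ : IsNoncrossing π) (a : Fin n → X)
    (S : Finset (Fin n)) (hS : ∀ x ∈ S, π.part x ⊆ S) :
    nestedEval f π a S = (∏ B ∈ π.parts with B ⊆ S, κ B.card (restrict a B)) • (1 : X) := by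
  classical
  induction hN : S.card using Nat.strong_induction_on generalizing S with
  | _ N ih =>
    subst hN
    rcases S.eq_empty_or_nonempty with rfl | hne
    · rw [nestedEval_empty, Finset.prod_eq_one, one_smul]
      intro B hB
      obtain ⟨h1, h2⟩ := Finset.mem_filter.1 hB
      exact absurd (Finset.subset_empty.1 h2) (π.ne_empty h1)
    set m := S.min' hne
    have hmS : m ∈ S := S.min'_mem hne
    obtain ⟨V, hV⟩ : ∃ V, π.part m = V := ⟨_, rfl⟩
    have hVS : V ⊆ S := hV ▸ hS m hmS
    have hV' : π.part m ∩ S = V := by rw [hV]; exact Finset.inter_eq_left.2 hVS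
    have hVp : V ∈ π.parts := hV ▸ π.part_mem.2 (Finset.mem_univ m)
    have hmV : m ∈ V := hV ▸ mem_part_refl π m
    have hmin : ∀ t ∈ S, m ≤ t := fun t ht => S.min'_le t ht
    set v : Fin V.card → Fin n := fun j => V.orderEmbOfFin rfl j
    have hvV : ∀ j, v j ∈ V := fun j => Finset.orderEmbOfFin_mem V rfl j
    have hblock : ∀ j, ∀ t ∈ gap S V (v j), π.part t ⊆ gap S V (v j) := fun j t ht t' ht' =>
      mem_gap_of_mem_part hπ hV' hmS hmin (hvV j) ht (hS t (mem_gap.1 ht).1 ht') ht'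
    rw [nestedEval_eq f π a hne hV']
    have hargs : ∀ j, a (V.orderEmbOfFin rfl j) * nestedEval f π a (gap S V (V.orderEmbOfFin rfl j))
        = (∏ B ∈ π.parts with B ⊆ gap S V (v j), κ B.card (restrict a B)) • restrict a V j := by
      intro j
      rw [ih _ (gap_card_lt (hVS (hvV j))) _ (hblock j) rfl, mul_smul_comm, mul_one]
      rfl
    obtain ⟨M, hM⟩ := hf V.card
    simp only [hargs]
    rw [← hM, M.map_smul_univ, hM, hκ, smul_smul]
    congr 1
    -- Apart from the first block, every block inside `S` lies in exactly one gap, so the product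
    -- over blocks factors along the gaps.
    have hsplit : π.parts.filter (· ⊆ S) = insert V
        (Finset.univ.biUnion fun j => π.parts.filter (· ⊆ gap S V (v j))) := by
      ext B
      simp only [Finset.mem_filter, Finset.mem_insert, Finset.mem_biUnion, Finset.mem_univ,
        true_and]
      constructor
      · rintro ⟨hB, hBS⟩
        refine or_iff_not_imp_left.2 fun hBV => ?_
        obtain ⟨t, ht⟩ := π.nonempty_of_mem_parts hB
        have htV : t ∉ V := fun h => hBV (π.eq_of_mem_parts hB hVp ht h)
        obtain ⟨w, hw, hg⟩ := exists_mem_gap (hBS ht) hmV (hmin t (hBS ht)) htV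
        obtain ⟨j, rfl⟩ := exists_orderEmbOfFin_eq hw
        refine ⟨j, hB, ?_⟩
        rw [← π.part_eq_of_mem hB ht]
        exact hblock j t hg
      · rintro (rfl | ⟨j, hB, hBg⟩)
        · exact ⟨hVp, hVS⟩
        · exact ⟨hB, hBg.trans (Finset.filter_subset _ _)⟩
    rw [hsplit, Finset.prod_insert, Finset.prod_biUnion, mul_comm]
    · intro j _ j' _ hjj'
      rw [Function.onFun, Finset.disjoint_left]
      intro B hB hB'
      obtain ⟨hB, h1⟩ := Finset.mem_filter.1 hB
      obtain ⟨t, ht⟩ := π.nonempty_of_mem_parts hB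
      exact hjj' ((V.orderEmbOfFin rfl).injective
        (gap_unique (hvV j) (hvV j') (h1 ht) ((Finset.mem_filter.1 hB').2 ht)))
    · intro h
      obtain ⟨j, -, hj⟩ := Finset.mem_biUnion.1 h
      exact notMem_of_mem_gap ((Finset.mem_filter.1 hj).2 hmV) hmV

/-- The expectation `a ↦ φ a • 1` onto the scalars. -/
def scalarExp {X : Type*} [Ring X] [Algebra ℂ X] (φ : X →ₗ[ℂ] ℂ) : X →ₗ[ℂ] X :=
  φ.smulRight 1

theorem scalarExp_apply {X : Type*} [Ring X] [Algebra ℂ X] (φ : X →ₗ[ℂ] ℂ) (a : X) :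
    scalarExp φ a = φ a • 1 := rfl

theorem isCondExp_scalarExp {X : Type*} [Ring X] [Algebra ℂ X] {φ : X →ₗ[ℂ] ℂ} (h : φ 1 = 1) :
    IsCondExp (scalarExp φ) where
  map_one := by rw [scalarExp_apply, h, one_smul]
  map_left a b := by
    simp only [scalarExp_apply φ a, smul_mul_assoc, one_mul, map_smul]
  map_right a b := by simp only [scalarExp_apply φ b, mul_smul_comm, mul_one, map_smul]

/-- For scalar values nesting is just multiplication, so the two recursions agree term by term. This
brings the self-adjoint setting under the operator-valued results. -/
theorem nestedCumulant_scalarExp {X : Type*} [Ring X] [Algebra ℂ X] (φ : X →ₗ[ℂ] ℂ) {n : ℕ}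
    (a : Fin n → X) : nestedCumulant (scalarExp φ) n a = freeCumulant φ n a • (1 : X) := by
  induction n using Nat.strong_induction_on with
  | _ n ih =>
    rw [nestedCumulant.eq_1, freeCumulant.eq_1, sub_smul, Finset.sum_smul]
    congr 1
    refine Finset.sum_congr rfl fun π hπ => ?_
    rw [nestedEval_eq_prod (isMultilinearFamily_truncate
        fun k _ => nestedCumulant_multilinear (scalarExp φ) k)
      (κ := fun k b => if _h : k < n then freeCumulant φ k b else 0) ?_ (mem_NC.1 hπ) a
      Finset.univ fun x _ => Finset.subset_univ _, Finset.filter_true_of_mem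
      fun B _ => Finset.subset_univ B]
    intro k b
    by_cases hk : k < n
    · simp [hk, ih k hk]
    · simp [hk]

theorem freeCumulant_two {X : Type*} [Ring X] [Algebra ℂ X] {φ : X →ₗ[ℂ] ℂ} (h1 : φ 1 = 1) {a : X}
    (ha : φ a = 0) : freeCumulant φ 2 (fun _ => a) = φ (a ^ 2) := by
  have hE := isCondExp_scalarExp h1
  have h2 := moment_eq_foldr (scalarExp φ) hE.map_one a [a]
  have h3 : closeBlock (scalarExp φ) [] a (1 * a) = 0 := closingFun_eq_zero hE
    (by rw [scalarExp_apply, one_mul, ha, zero_smul]) [] a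
  rw [List.foldr_cons, readLetter, List.foldr_nil, h3, if_pos rfl, zero_add, closeBlock,
    hE.map_one] at h2
  have h4 := nestedCumulant_scalarExp φ (fun _ : Fin 2 => a)
  rw [nestedCumulant_eq_listCumulant] at h4
  have h5 : List.ofFn (fun _ : Fin 2 => a) = [] ++ [a * 1] ++ [a * 1] := by simp [List.ofFn_succ]
  rw [h5, ← h2, scalarExp_apply] at h4
  have h6 := congrArg φ h4
  simpa [h1, pow_two] using h6.symm

/-! ### Orthogonal matrices -/

section Orthogonal

variable {s : ℕ} {A : Matrix (Fin s) (Fin s) ℝ}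

theorem sum_mul_col (hA : A ∈ Matrix.orthogonalGroup (Fin s) ℝ) (j j' : Fin s) :
    ∑ p, A p j * A p j' = if j = j' then 1 else 0 := by
  have := congrFun (congrFun ((Matrix.mem_orthogonalGroup_iff' _ _).1 hA) j) j'
  rwa [Matrix.mul_apply, Matrix.one_apply] at this

theorem sum_mul_row (hA : A ∈ Matrix.orthogonalGroup (Fin s) ℝ) (p q : Fin s) :
    ∑ j, A p j * A q j = if p = q then 1 else 0 := by
  have := congrFun (congrFun ((Matrix.mem_orthogonalGroup_iff _ _).1 hA) p) q
  rwa [Matrix.mul_apply, Matrix.one_apply] at this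

/-- If the diagonal tensor `v` is mapped by `A` to a diagonal tensor of order at least three, the
columns of `A` where `v` does not vanish have a single nonzero entry. -/
theorem col_mul_eq_zero_of_tensor (hA : A ∈ Matrix.orthogonalGroup (Fin s) ℝ) {n : ℕ} (hn : 3 ≤ n)
    {v : Fin s → ℂ} (hv : ∀ i : Fin n → Fin s, (∃ k k', i k ≠ i k') →
      ∑ j, (∏ k, (A (i k) j : ℂ)) * v j = 0) {j : Fin s} (hj : v j ≠ 0) {p q : Fin s}
    (hpq : p ≠ q) : A p j * A q j = 0 := by
  obtain ⟨m, rfl⟩ : ∃ m, n = m + 3 := ⟨n - 3, by omega⟩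
  -- The tensor with one index left free, the next equal to `p` and the other `m + 1` equal to `q`.
  -- Order at least three makes the power of `A q j` positive.
  set w : Fin s → ℂ := fun j => A p j * ((A q j) ^ (m + 1) * v j) with hw
  have h1 : ∀ r, ∑ j, (A r j : ℂ) * w j = 0 := by
    intro r
    rw [← hv (Fin.cons r (Fin.cons p fun _ => q)) ⟨1, 2, hpq⟩]
    refine Finset.sum_congr rfl fun j _ => ?_
    rw [Fin.prod_univ_succ, Fin.prod_univ_succ]
    simp [hw, mul_assoc]
  -- This is `AᵀA w = w`; together with `A w = 0` it forces `w = 0`.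
  have h2 : ∑ r, (A r j : ℂ) * ∑ j', (A r j' : ℂ) * w j' = w j := by
    simp only [Finset.mul_sum, ← mul_assoc]
    rw [Finset.sum_comm]
    simp only [← Finset.sum_mul]
    have h3 : ∀ j', ∑ r, (A r j : ℂ) * A r j' = if j = j' then 1 else 0 := by
      intro j'
      have := congrArg (fun t : ℝ => (t : ℂ)) (sum_mul_col hA j j')
      push_cast at this
      rw [this]
      split_ifs <;> simp
    simp [h3]
  simp only [h1, mul_zero, Finset.sum_const_zero] at h2
  have h3 : (A p j : ℂ) * ((A q j : ℂ) ^ (m + 1) * v j) = 0 := h2.symm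
  rcases mul_eq_zero.1 h3 with h | h
  · rw [Complex.ofReal_eq_zero.1 h, zero_mul]
  · have := pow_eq_zero_iff (by omega) |>.1 ((mul_eq_zero.1 h).resolve_right hj)
    rw [Complex.ofReal_eq_zero.1 this, mul_zero]

/-- An orthogonal matrix all of whose columns but at most one have a single nonzero entry is a
signed permutation matrix. -/
theorem exists_perm_of_col (hA : A ∈ Matrix.orthogonalGroup (Fin s) ℝ) {P : Fin s → Prop}
    (hP : ∀ i j, P i → P j → i = j) (hcol : ∀ j, ¬ P j → ∀ p q, p ≠ q → A p j * A q j = 0) :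
    ∃ (σ : Equiv.Perm (Fin s)) (ε : Fin s → ℝ), (∀ i, ε i = 1 ∨ ε i = -1) ∧
      ∀ p j, A p j = if p = σ j then ε j else 0 := by
  have hall : ∀ j p q, p ≠ q → A p j * A q j = 0 := by
    intro j p q hpq
    by_cases hj : P j
    · have := sum_mul_row hA p q
      rwa [if_neg hpq, Finset.sum_eq_single j (fun j' _ hj' =>
        hcol j' (fun h => hj' (hP _ _ h hj)) p q hpq) (fun h => absurd (Finset.mem_univ j) h)]
        at this
    · exact hcol j hj p q hpq
  have hex : ∀ j, ∃ p, A p j ≠ 0 := by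
    intro j
    by_contra! h
    have := sum_mul_col hA j j
    simp [h] at this
  choose σ hσ using hex
  have hzero : ∀ j p, p ≠ σ j → A p j = 0 := fun j p hp =>
    (mul_eq_zero.1 (hall j p (σ j) hp)).resolve_right (hσ j)
  have hsum : ∀ j j', A (σ j) j * A (σ j) j' = if j = j' then 1 else 0 := by
    intro j j'
    rw [← sum_mul_col hA j j', Finset.sum_eq_single (σ j) (fun p _ hp => by
      rw [hzero j p hp, zero_mul]) (fun h => absurd (Finset.mem_univ _) h)]
  have hinj : Function.Injective σ := by
    intro j j' h
    by_contra hne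
    have := hsum j j'
    rw [if_neg hne] at this
    rcases mul_eq_zero.1 this with h' | h'
    · exact hσ j h'
    · exact hσ j' (h ▸ h')
  refine ⟨Equiv.ofBijective σ (Finite.injective_iff_bijective.1 hinj), fun j => A (σ j) j,
    fun j => ?_, fun p j => ?_⟩
  · have := hsum j j
    rw [if_pos rfl] at this
    exact mul_self_eq_one_iff.1 this
  · rw [Equiv.ofBijective_apply]
    split_ifs with h
    · rw [h]
    · exact hzero j p h

/-- If `Wᵀ Q` is a signed permutation matrix, then `W` and `Q` agree up to signed permutations of
the columns. -/
theorem eq_mul_perm_of_transpose_mul {Q W : Matrix (Fin s) (Fin s) ℝ}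
    (hQ : Q ∈ Matrix.orthogonalGroup (Fin s) ℝ) (hW : W ∈ Matrix.orthogonalGroup (Fin s) ℝ)
    {σ : Equiv.Perm (Fin s)} {ε : Fin s → ℝ} (hε : ∀ i, ε i = 1 ∨ ε i = -1)
    (h : ∀ p j, (W.transpose * Q) p j = if p = σ j then ε j else 0) :
    (∃ (σ : Equiv.Perm (Fin s)) (ε : Fin s → ℝ), (∀ i, ε i = 1 ∨ ε i = -1) ∧
      W = Q * σ.permMatrix ℝ * Matrix.diagonal ε) ∧
    (∃ (σ : Equiv.Perm (Fin s)) (ε : Fin s → ℝ), (∀ i, ε i = 1 ∨ ε i = -1) ∧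
      Q = W * σ.permMatrix ℝ * Matrix.diagonal ε) := by
  have hQ1 : Q * Q.transpose = 1 := (Matrix.mem_orthogonalGroup_iff _ _).1 hQ
  have hW1 : W * W.transpose = 1 := (Matrix.mem_orthogonalGroup_iff _ _).1 hW
  -- `σ.permMatrix` has its ones at `(p, σ p)`, whereas `Wᵀ * Q` is supported at `(σ j, j)`. The
  -- inverse therefore belongs to `Q`, and transposing for `W` relabels the signs.
  refine ⟨⟨σ, fun j => ε (σ.symm j), fun j => hε _, ?_⟩, ⟨σ⁻¹, ε, hε, ?_⟩⟩
  · have : (W.transpose * Q).transpose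
        = σ.permMatrix ℝ * Matrix.diagonal fun j => ε (σ.symm j) := by
      ext p j
      rw [Matrix.transpose_apply, h, Matrix.mul_diagonal, Equiv.Perm.permMatrix,
        PEquiv.toMatrix_apply]
      by_cases hp : j = σ p <;> simp [hp, eq_comm]
    rw [mul_assoc, ← this, Matrix.transpose_mul, Matrix.transpose_transpose, ← mul_assoc, hQ1,
      one_mul]
  · have : W.transpose * Q = (σ⁻¹).permMatrix ℝ * Matrix.diagonal ε := by
      ext p j
      rw [h, Matrix.mul_diagonal, Equiv.Perm.permMatrix, PEquiv.toMatrix_apply]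
      by_cases hp : p = σ j
      · simp [hp]
      · have : σ.symm p ≠ j := fun h => hp (by rw [← h, Equiv.apply_symm_apply])
        simpa [hp] using fun h => absurd h this
    rw [mul_assoc, ← this, ← mul_assoc, hW1, one_mul]

end Orthogonal

/-! ### Linear combinations of free elements -/

/-- If `x` and its image `z` under an orthogonal matrix `A` are both free families, the columns of
`A` belonging to elements with a nonzero `*`-cumulant of order at least three have a single nonzero
entry. -/
theorem col_mul_eq_zero_of_free {X : Type*} [Ring X] [StarRing X] [Algebra ℂ X] [StarModule ℂ X]
    {E : X →ₗ[ℂ] X} (hE : IsCondExp E) (ψ : X →ₗ[ℂ] ℂ) {s : ℕ} {A : Matrix (Fin s) (Fin s) ℝ}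
    (hA : A ∈ Matrix.orthogonalGroup (Fin s) ℝ) {x z : Fin s → X}
    (hz : ∀ i, z i = ∑ j, (A i j : ℂ) • x j) {S T : Fin s → Subalgebra ℂ X}
    (hS : ∀ c a, E a ∈ S c) (hT : ∀ c a, E a ∈ T c) (hSfree : IsFreeFamily E S)
    (hTfree : IsFreeFamily E T) (hxS : ∀ i, x i ∈ S i) (hxS' : ∀ i, star (x i) ∈ S i)
    (hzT : ∀ i, z i ∈ T i) (hzT' : ∀ i, star (z i) ∈ T i) {n : ℕ} (hn : 3 ≤ n)
    (L : Fin n → X → X) (hL : ∀ k, L k = id ∨ L k = star) {j : Fin s}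
    (hj : ψ (nestedCumulant E n fun k => L k (x j)) ≠ 0) {p q : Fin s} (hpq : p ≠ q) :
    A p j * A q j = 0 := by
  have hLx : ∀ k i, L k (x i) ∈ S i := fun k i => by
    rcases hL k with h | h <;> rw [h]
    exacts [hxS i, hxS' i]
  have hLz : ∀ k i, L k (z i) ∈ T i := fun k i => by
    rcases hL k with h | h <;> rw [h]
    exacts [hzT i, hzT' i]
  have hLlin : ∀ k i, L k (z i) = ∑ j, (A i j : ℂ) • L k (x j) := fun k i => by
    rcases hL k with h | h <;> rw [h, hz]
    · rfl
    · simp [star_sum, star_smul]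
  obtain ⟨M, hM⟩ := nestedCumulant_multilinear E n
  refine col_mul_eq_zero_of_tensor hA hn
    (v := fun j => ψ (nestedCumulant E n fun k => L k (x j))) (fun i hi => ?_) hj hpq
  have h1 : nestedCumulant E n (fun k => L k (z (i k))) = 0 :=
    nestedCumulant_eq_zero_of_mixed hE hT hTfree i _ (fun k => hLz k (i k)) hi
  simp only [hLlin] at h1
  rw [← hM, M.map_sum] at h1
  simp only [M.map_smul_univ, hM] at h1
  -- In the multilinear expansion over index tuples only constant tuples contribute, because mixed
  -- cumulants of the `x i` vanish.
  rw [← Fintype.sum_of_injective (fun (j : Fin s) (_ : Fin n) => j)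
    (fun j j' h => congrFun h ⟨0, by omega⟩)
    (fun j => (∏ k, (A (i k) j : ℂ)) • nestedCumulant E n fun k => L k (x j)) _ ?_
    (fun _ => rfl)] at h1
  · have := congrArg ψ h1
    simpa [map_sum] using this
  · intro r hr
    rw [nestedCumulant_eq_zero_of_mixed hE hS hSfree r _ (fun k => hLx k (r k)), smul_zero]
    by_contra! hc
    exact hr ⟨r ⟨0, by omega⟩, funext fun k => hc _ _⟩

/-! ### The two settings -/

theorem IsFreeFamily.scalarExp {X ι : Type*} [Ring X] [Algebra ℂ X] {φ : X →ₗ[ℂ] ℂ}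
    (h1 : φ 1 = 1) {A : ι → Subalgebra ℂ X} (h : IsFreeFamily φ A) :
    IsFreeFamily (scalarExp φ) A := by
  have h0 : ∀ a, FreeICA.scalarExp φ a = 0 → φ a = 0 := fun a ha => by
    have := congrArg φ ha
    simpa [scalarExp_apply, h1] using this
  intro k hk i x hx hx0 hi
  rw [scalarExp_apply, h k hk i x hx (fun j => h0 _ (hx0 j)) hi, zero_smul]

/-- `cornerState` as a linear functional. -/
noncomputable def cornerFunctional {X : Type*} [Ring X] [Algebra ℂ X] (φ : X →ₗ[ℂ] ℂ) (p : X) :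
    X →ₗ[ℂ] ℂ :=
  (φ p)⁻¹ • φ ∘ₗ LinearMap.mulRight ℂ p ∘ₗ LinearMap.mulLeft ℂ p

theorem cornerFunctional_apply {X : Type*} [Ring X] [Algebra ℂ X] (φ : X →ₗ[ℂ] ℂ) (p a : X) :
    cornerFunctional φ p a = cornerState φ p a := by
  simp [cornerFunctional, cornerState, div_eq_inv_mul]

/-- `condExpD` as a linear map. -/
noncomputable def condExpLinear {X : Type*} [Ring X] [Algebra ℂ X] (φ : X →ₗ[ℂ] ℂ) (p₁ p₂ : X) :
    X →ₗ[ℂ] X :=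
  (cornerFunctional φ p₁).smulRight p₁ + (cornerFunctional φ p₂).smulRight p₂

theorem coe_condExpLinear {X : Type*} [Ring X] [Algebra ℂ X] (φ : X →ₗ[ℂ] ℂ) (p₁ p₂ : X) :
    ⇑(condExpLinear φ p₁ p₂) = condExpD φ p₁ p₂ := by
  funext a
  simp [condExpLinear, condExpD, cornerFunctional_apply]

/-- The corner functionals see only `p a p`, so multiplying by a projection on either side fixes or
kills them; the nonzero weights give `E 1 = 1`. -/
theorem isCondExp_condExpLinear {X : Type*} [Ring X] [StarRing X] [Algebra ℂ X] {φ : X →ₗ[ℂ] ℂ}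
    {p₁ p₂ : X} (h : IsRectangular φ p₁ p₂) : IsCondExp (condExpLinear φ p₁ p₂) := by
  have h11 : p₁ * p₁ = p₁ := h.proj₁.isIdempotentElem
  have h22 : p₂ * p₂ = p₂ := h.proj₂.isIdempotentElem
  have h12 := h.mul₁₂
  have h21 := h.mul₂₁
  have hs : ∀ (p a : X) (r : ℂ), cornerState φ p (r • a) = r * cornerState φ p a := fun p a r => by
    rw [← cornerFunctional_apply, map_smul, smul_eq_mul, cornerFunctional_apply]
  have ha : ∀ (p a b : X), cornerState φ p (a + b) = cornerState φ p a + cornerState φ p b :=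
    fun p a b => by
      rw [← cornerFunctional_apply, map_add, cornerFunctional_apply, cornerFunctional_apply]
  have l11 : ∀ a, cornerState φ p₁ (p₁ * a) = cornerState φ p₁ a := fun a => by
    rw [cornerState, cornerState, ← mul_assoc, h11]
  have l12 : ∀ a, cornerState φ p₁ (p₂ * a) = 0 := fun a => by
    rw [cornerState, ← mul_assoc, h12, zero_mul, zero_mul, map_zero, zero_div]
  have l21 : ∀ a, cornerState φ p₂ (p₁ * a) = 0 := fun a => by
    rw [cornerState, ← mul_assoc, h21, zero_mul, zero_mul, map_zero, zero_div]
  have l22 : ∀ a, cornerState φ p₂ (p₂ * a) = cornerState φ p₂ a := fun a => by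
    rw [cornerState, cornerState, ← mul_assoc, h22]
  have r11 : ∀ a, cornerState φ p₁ (a * p₁) = cornerState φ p₁ a := fun a => by
    rw [cornerState, cornerState, mul_assoc, mul_assoc, h11, mul_assoc]
  have r12 : ∀ a, cornerState φ p₁ (a * p₂) = 0 := fun a => by
    rw [cornerState, mul_assoc, mul_assoc, h21, mul_zero, mul_zero, map_zero, zero_div]
  have r21 : ∀ a, cornerState φ p₂ (a * p₁) = 0 := fun a => by
    rw [cornerState, mul_assoc, mul_assoc, h12, mul_zero, mul_zero, map_zero, zero_div]
  have r22 : ∀ a, cornerState φ p₂ (a * p₂) = cornerState φ p₂ a := fun a => by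
    rw [cornerState, cornerState, mul_assoc, mul_assoc, h22, mul_assoc]
  refine ⟨?_, fun a b => ?_, fun a b => ?_⟩ <;> simp only [coe_condExpLinear, condExpD]
  · have c1 : cornerState φ p₁ 1 = 1 := by
      rw [cornerState, mul_one, h11, div_self h.weight₁]
    have c2 : cornerState φ p₂ 1 = 1 := by
      rw [cornerState, mul_one, h22, div_self h.weight₂]
    rw [c1, c2, one_smul, one_smul, h.add_eq_one]
  · simp only [add_mul, mul_add, smul_mul_assoc, mul_smul_comm, ha, hs, l11, l12, l21, l22, h11,
      h22, h12, h21, mul_zero, add_zero, zero_add, smul_zero, smul_smul]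
    simp only [mul_comm]
  · simp only [add_mul, mul_add, smul_mul_assoc, mul_smul_comm, ha, hs, r11, r12, r21, r22, h11,
      h22, h12, h21, mul_zero, add_zero, zero_add, smul_zero, smul_smul]

-- Unit variance makes the positivity clause automatic, so only a higher cumulant can prevent `a`
-- from being semicircular.
open scoped ComplexOrder in
theorem exists_freeCumulant_ne_zero {X : Type*} [Ring X] [Algebra ℂ X] {φ : X →ₗ[ℂ] ℂ}
    (h1 : φ 1 = 1) {a : X} (ha : φ a = 0) (ha2 : φ (a ^ 2) = 1) (h : ¬ IsSemicircular φ a) :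
    ∃ m, 3 ≤ m ∧ freeCumulant φ m (fun _ => a) ≠ 0 := by
  by_contra! hc
  refine h ⟨hc, ?_⟩
  rw [freeCumulant_two h1 ha, ha2]
  exact zero_lt_one

end FreeICA

/-! ### The identifiability theorem. -/

theorem mainTheorem2 {X : Type*} [Ring X] [StarRing X] [Algebra ℂ X] [StarModule ℂ X]
    (φ : X →ₗ[ℂ] ℂ) (hφ : FreeICA.IsTracialState φ)
    (s : ℕ) (Q W : Matrix (Fin s) (Fin s) ℝ)
    (hQ : Q ∈ Matrix.orthogonalGroup (Fin s) ℝ) (hW : W ∈ Matrix.orthogonalGroup (Fin s) ℝ)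
    (x y : Fin s → X) (hy : ∀ i, y i = ∑ j, (Q i j : ℂ) • x j)
    (hsetting :
      -- the self-adjoint setting
      ((∀ i, IsSelfAdjoint (x i)) ∧ (∀ i, φ (x i) = 0) ∧ (∀ i, φ (x i ^ 2) = 1) ∧
        FreeICA.AreFree φ x ∧
        (∀ i j, FreeICA.IsSemicircular φ (x i) → FreeICA.IsSemicircular φ (x j) → i = j) ∧
        FreeICA.AreFree φ (fun i => ∑ j, (W.transpose i j : ℂ) • y j)) ∨
      -- the rectangular setting
      (∃ p₁ p₂ : X, FreeICA.IsRectangular φ p₁ p₂ ∧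
        (∀ i, x i = p₁ * x i * p₂) ∧
        (∀ i, FreeICA.cornerState φ p₁ (x i * star (x i)) = 1) ∧
        FreeICA.AreFreeRect φ p₁ p₂ x ∧
        (∀ i j, FreeICA.IsFreePoisson φ p₁ p₂ (x i) →
          FreeICA.IsFreePoisson φ p₁ p₂ (x j) → i = j) ∧
        FreeICA.AreFreeRect φ p₁ p₂ (fun i => ∑ j, (W.transpose i j : ℂ) • y j))) :
    (∃ (σ : Equiv.Perm (Fin s)) (ε : Fin s → ℝ), (∀ i, ε i = 1 ∨ ε i = -1) ∧
      W = Q * σ.permMatrix ℝ * Matrix.diagonal ε) ∧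
    (∃ (σ : Equiv.Perm (Fin s)) (ε : Fin s → ℝ), (∀ i, ε i = 1 ∨ ε i = -1) ∧
      Q = W * σ.permMatrix ℝ * Matrix.diagonal ε) := by
  have hA : W.transpose * Q ∈ Matrix.orthogonalGroup (Fin s) ℝ :=
    mul_mem (Unitary.star_mem hW) hQ
  have hz : ∀ i, (fun i => ∑ j, (W.transpose i j : ℂ) • y j) i
      = ∑ j, ((W.transpose * Q) i j : ℂ) • x j := by
    intro i
    simp only [hy, Finset.smul_sum, smul_smul]
    rw [Finset.sum_comm]
    refine Finset.sum_congr rfl fun j _ => ?_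
    rw [← Finset.sum_smul, Matrix.mul_apply]
    push_cast
    rfl
  generalize (fun i => ∑ j, (W.transpose i j : ℂ) • y j) = z at hz hsetting
  -- `P` marks the possible exceptional column: the semicircular element in one setting, the free
  -- Poisson element in the other.
  obtain ⟨P, hP, hcol⟩ : ∃ P : Fin s → Prop, (∀ i j, P i → P j → i = j) ∧
      ∀ j, ¬ P j → ∀ p q, p ≠ q →
        (W.transpose * Q) p j * (W.transpose * Q) q j = 0 := by
    rcases hsetting with ⟨-, hx0, hx2, hxfree, hsc, hzfree⟩ | ⟨p₁, p₂, hp, -, -, hxfree, hfp, hzfree⟩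
    · refine ⟨fun i => FreeICA.IsSemicircular φ (x i), hsc, fun j hj p q hpq => ?_⟩
      obtain ⟨m, hm, hne⟩ :=
        FreeICA.exists_freeCumulant_ne_zero hφ.map_one (hx0 j) (hx2 j) hj
      have hmem : ∀ (w : Fin s → X) (c : Fin s) (a : X),
          FreeICA.scalarExp φ a ∈ Algebra.adjoin ℂ {w c, star (w c)} := fun w c a =>
        Subalgebra.smul_mem _ (Subalgebra.one_mem _) _
      refine FreeICA.col_mul_eq_zero_of_free (FreeICA.isCondExp_scalarExp hφ.map_one) φ hA hz
        (hmem x) (hmem z) (FreeICA.IsFreeFamily.scalarExp hφ.map_one hxfree)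
        (FreeICA.IsFreeFamily.scalarExp hφ.map_one hzfree)
        (fun i => Algebra.subset_adjoin (by simp)) (fun i => Algebra.subset_adjoin (by simp))
        (fun i => Algebra.subset_adjoin (by simp)) (fun i => Algebra.subset_adjoin (by simp))
        hm (fun _ => id) (fun _ => Or.inl rfl) ?_ hpq
      simpa [FreeICA.nestedCumulant_scalarExp, hφ.map_one] using hne
    · refine ⟨fun i => FreeICA.IsFreePoisson φ p₁ p₂ (x i), hfp, fun j hj p q hpq => ?_⟩
      simp only [FreeICA.IsFreePoisson] at hj
      push Not at hj
      obtain ⟨m, hm, hne⟩ := hj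
      have hmem : ∀ (w : Fin s → X) (c : Fin s) (a : X), FreeICA.condExpLinear φ p₁ p₂ a ∈
          Algebra.adjoin ℂ {p₁, p₂, w c, star (w c)} := fun w c a =>
        Subalgebra.add_mem _
          (Subalgebra.smul_mem _ (Algebra.subset_adjoin (by simp)) _)
          (Subalgebra.smul_mem _ (Algebra.subset_adjoin (by simp)) _)
      rw [FreeICA.AreFreeRect, ← FreeICA.coe_condExpLinear] at hxfree hzfree
      refine FreeICA.col_mul_eq_zero_of_free (FreeICA.isCondExp_condExpLinear hp)
        (FreeICA.cornerFunctional φ p₁) hA hz (hmem x) (hmem z) hxfree hzfree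
        (fun i => Algebra.subset_adjoin (by simp)) (fun i => Algebra.subset_adjoin (by simp))
        (fun i => Algebra.subset_adjoin (by simp)) (fun i => Algebra.subset_adjoin (by simp))
        -- Failure of the free Poisson condition gives `m ≥ 2`, so the alternating cumulant has
        -- order at least four.
        (n := 2 * m) (by omega) (fun k a => if Even (k : ℕ) then a else star a)
        (fun k => ?_) ?_ hpq
      · by_cases hk : Even (k : ℕ)
        · exact Or.inl (by funext a; simp [hk])
        · exact Or.inr (by funext a; simp [hk])
      · rw [FreeICA.cornerFunctional_apply, FreeICA.coe_condExpLinear]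
        exact hne
  obtain ⟨σ, ε, hε, h⟩ := FreeICA.exists_perm_of_col hA hP hcol
  exact FreeICA.eq_mul_perm_of_transpose_mul hQ hW hε h
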